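/- **Theorem.** Let $\mathbf p=(p_k)_{k\ge 0}$ be an offspring distribution with $p_0=0$ and finite mean $m>1$, and let $\mathbb T$ be the Galton--Watson tree with offspring distribution $\mathbf p$, rooted at $\varnothing$. Write $|x|$ for the depth of a vertex $x$, $\mathbb T_n=\{x\in\mathbb T:|x|=n\}$ for the $n$-th level, and $\nu$ for the number of children of the root. Let $\xi$ be a nonnegative random variable and, conditionally on $\mathbb T$, let $\{\xi(e)\}$, indexed by the edges $e$ of $\mathbb T$, be i.i.d. copies of $\xi$. Give the edge $e$ joining a vertex $x\ne\varnothing$ to its parent the resistance $r(e)=m^{|x|}\,\xi(e)$. For $n\ge1$ let $R_n$ be the effective resistance between $\varnothing$ and $\mathbb T_n$ in the network $(\mathbb T,\{r(e)\})$, that is, the infimum of $\sum_e r(e)\theta(e)^2$ over all flows $\theta$ of unit strength from $\{\varnothing\}$ to $\mathbb T_n$, and let $C_n=R_n^{-1}$ be the effective conductance. Assume that $\mathbb E[\xi+\xi^{-1}+\nu^2]<\infty$. Then $0<\mathbb E[C_n]<\infty$ for every $n\ge1$, the limit $W=\lim_{n\to\infty}m^{-n}\,\#\mathbb T_n$ exists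 and is finite almost surely, and almost surely $$\frac{C_n}{\mathbb E[C_n]}\;\longrightarrow\; W\qquad (n\to\infty).$$ -/

import Mathlib

open MeasureTheory ProbabilityTheory Filter Topology
open scoped NNReal ENNReal

/-! ### Electric networks: flows, effective resistance, effective conductance -/

/-- A flow on a graph: an antisymmetric function of directed edges. The values at pairs of
non-adjacent vertices are never used. -/
structure NetworkFlow (V : Type*) where
  toFun : V → V → ℝ
  antisymm : ∀ x y, toFun x y = -toFun y x

namespace NetworkFlow

variable {V : Type*}

/-- The square `θ(e)²`, as a function of the undirected edge `e`. -/
def sq (θ : NetworkFlow V) : Sym2 V → ℝ :=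
  Sym2.lift ⟨fun x y => θ.toFun x y ^ 2, fun x y => by simp only [θ.antisymm x y, neg_sq]⟩

/-- The divergence of `θ` at the vertex `x`: the total flow out of `x`. -/
def div (G : SimpleGraph V) [G.LocallyFinite] (θ : NetworkFlow V) (x : V) : ℝ :=
  ∑ y ∈ G.neighborFinset x, θ.toFun x y

open Classical in
/-- `θ` is a flow from the source set `A` to the sink set `Z` with strength `s`. -/
structure IsFromTo (G : SimpleGraph V) [G.LocallyFinite] (A Z : Finset V) (s : ℝ)
    (θ : NetworkFlow V) : Prop where
  node_law : ∀ x, x ∉ A → x ∉ Z → θ.div G x = 0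
  source : ∑ a ∈ A, ∑ y ∈ G.neighborFinset a with y ∉ A, θ.toFun a y = s
  sink : ∑ z ∈ Z, ∑ y ∈ G.neighborFinset z with y ∉ Z, θ.toFun y z = s

/-- The energy `∑ r(e) θ(e)²`, the sum being over all edges of the graph. -/
noncomputable def energy (G : SimpleGraph V) (r : Sym2 V → ℝ≥0) (θ : NetworkFlow V) : ℝ≥0∞ :=
  ∑' e : G.edgeSet, (r e : ℝ≥0∞) * ENNReal.ofReal (θ.sq e)

end NetworkFlow

/-- The effective resistance between the disjoint sets `A` and `Z` in the network with graph `G`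
and resistances `r`: the least energy of a flow of unit strength from `A` to `Z`. -/
noncomputable def effectiveResistance {V : Type*} (G : SimpleGraph V) [G.LocallyFinite]
    (r : Sym2 V → ℝ≥0) (A Z : Finset V) : ℝ≥0∞ :=
  ⨅ (θ : NetworkFlow V) (_ : θ.IsFromTo G A Z 1), θ.energy G r

/-- The effective conductance is the reciprocal of the effective resistance. -/
noncomputable def effectiveConductance {V : Type*} (G : SimpleGraph V) [G.LocallyFinite]
    (r : Sym2 V → ℝ≥0) (A Z : Finset V) : ℝ≥0∞ :=
  (effectiveResistance G r A Z)⁻¹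

/-! ### Rooted trees coded by words -/

/-- The tree in which the vertex `u` has `N u` children, as a set of finite words: the root is the
empty word and the children of `u` are the words `u ++ [i]` with `i < N u`. -/
def plantedTree (N : List ℕ → ℕ) : Set (List ℕ) :=
  {x | ∀ u i, u ++ [i] <+: x → i < N u}

namespace plantedTree

theorem nil_mem (N : List ℕ → ℕ) : [] ∈ plantedTree N := by
  intro u i h
  simp at h

/-- The root. -/
def root (N : List ℕ → ℕ) : plantedTree N := ⟨[], nil_mem N⟩

theorem finite_words (N : List ℕ → ℕ) (n : ℕ) :
    {x : List ℕ | x ∈ plantedTree N ∧ x.length = n}.Finite := by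
  induction n with
  | zero =>
    refine (Set.finite_singleton ([] : List ℕ)).subset ?_
    rintro x ⟨_, hx⟩
    exact List.length_eq_zero_iff.mp hx
  | succ n ih =>
    refine (ih.biUnion (t := fun u => (fun i => u ++ [i]) '' Set.Iio (N u))
      (fun u _ => (Set.finite_Iio (N u)).image _)).subset ?_
    rintro x ⟨hx, hl⟩
    rcases List.eq_nil_or_concat' x with rfl | ⟨u, i, rfl⟩
    · simp at hl
    · refine Set.mem_biUnion (x := u) ⟨?_, by simpa using hl⟩ ⟨i, hx u i List.prefix_rfl, rfl⟩
      exact fun v j h => hx v j (h.trans (List.prefix_append u [i]))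

theorem finite_level (N : List ℕ → ℕ) (n : ℕ) :
    {x : plantedTree N | x.1.length = n}.Finite :=
  ((finite_words N n).preimage Subtype.val_injective.injOn).subset fun x hx => ⟨x.2, hx⟩

/-- The set of vertices at depth `n`. -/
noncomputable def level (N : List ℕ → ℕ) (n : ℕ) : Finset (plantedTree N) :=
  (finite_level N n).toFinset

/-- The graph of the tree: edges join each vertex to its children. -/
def graph (N : List ℕ → ℕ) : SimpleGraph (plantedTree N) :=
  SimpleGraph.fromRel fun x y => ∃ i, y.1 = x.1 ++ [i]

theorem finite_neighborSet (N : List ℕ → ℕ) (x : plantedTree N) :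
    ((graph N).neighborSet x).Finite := by
  refine ((finite_level N (x.1.length + 1)).union (finite_level N (x.1.length - 1))).subset ?_
  intro y hy
  rw [SimpleGraph.mem_neighborSet, graph, SimpleGraph.fromRel_adj] at hy
  rcases hy.2 with ⟨i, hi⟩ | ⟨i, hi⟩
  · left; simp [hi]
  · right; simp [hi]

noncomputable instance (N : List ℕ → ℕ) : (graph N).LocallyFinite :=
  fun x => (finite_neighborSet N x).fintype

/-- The resistance `m ^ d(e) * ξ(e)` of the edge `e`; here the depth `d(e)` is the depth of the
endpoint of `e` farther from the root, and `ξ(e)` is the mark carried by this endpoint. -/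
def resistance (m : ℝ≥0) (N : List ℕ → ℕ) (ξ : List ℕ → ℝ≥0) : Sym2 (plantedTree N) → ℝ≥0 :=
  Sym2.lift ⟨fun x y =>
    if x.1.length < y.1.length then m ^ y.1.length * ξ y.1
    else if y.1.length < x.1.length then m ^ x.1.length * ξ x.1
    else 0, fun x y => by
      rcases lt_trichotomy x.1.length y.1.length with h | h | h
      · simp [h, h.le]
      · simp [h]
      · simp [h, h.le]⟩

/-- The effective conductance between the root and the vertices at depth `n`. -/
noncomputable def conductance (m : ℝ≥0) (N : List ℕ → ℕ) (ξ : List ℕ → ℝ≥0) (n : ℕ) : ℝ≥0∞ :=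
  effectiveConductance (graph N) (resistance m N ξ) {root N} (level N n)

/-- The normalized size `m ^ (-n) * #T_n` of the level `n`. -/
noncomputable def normalizedSize (m : ℝ≥0) (N : List ℕ → ℕ) (n : ℕ) : ℝ≥0 :=
  ((level N n).card : ℝ≥0) / m ^ n

/-- The limit `W` of the normalized level sizes. -/
noncomputable def sizeLimit (m : ℝ≥0) (N : List ℕ → ℕ) : ℝ≥0 :=
  limUnder atTop (normalizedSize m N)

end plantedTree

/-! ### Branching random networks -/

/-- The mean of an offspring distribution (with value `0` if the mean is infinite). -/
noncomputable def offspringMean (p : PMF ℕ) : ℝ≥0 :=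
  (∑' k : ℕ, (k : ℝ≥0∞) * p k).toNNReal

/-- The numbers of children `N u` are i.i.d. with law `p`, so that `plantedTree (N · ω)` is a
Galton-Watson tree, and independently of them the marks `ξ x` (of the edge between `x ≠ ∅` and its
parent) are i.i.d. copies of `ξ₀`. -/
structure IsBranchingNetwork {Ω : Type*} [MeasurableSpace Ω] (P : Measure Ω) (p : PMF ℕ)
    (ξ₀ : Ω → ℝ≥0) (N : List ℕ → Ω → ℕ) (ξ : List ℕ → Ω → ℝ≥0) : Prop where
  offspring_law : ∀ u, HasLaw (N u) p.toMeasure P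
  offspring_indep : iIndepFun N P
  mark_identDistrib : ∀ x, x ≠ [] → IdentDistrib (ξ x) ξ₀ P P
  mark_indep : iIndepFun (fun x : {x : List ℕ // x ≠ []} => ξ x) P
  offspring_indep_mark :
    IndepFun (fun ω u => N u ω) (fun ω (x : {x : List ℕ // x ≠ []}) => ξ x ω) P

/-! Since resistances grow like `m ^ depth`, the series and parallel laws give `C_{n+1} = m⁻¹ ∑ (ξ_i
+ 1 / C_n(i))⁻¹`, the sum running over the children `i` of the root and `C_n(i)` being the
conductance of the subtree at `i`. So `C_{n+1}` arises from `C_n` by `inSeries` followed by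
`childMean`. By the branching property `childMean` preserves expectations, and it divides by `m` the
squared L² distance of two functions with equal means (`lintegral_sqDist_childMean`). The normalized
level size is the `n`-th iterate of `childMean` at `1`; the contraction makes it converge almost
surely to `W`.

Write `c_n = E[C_n]` and `s_n = E[C_n²]`. Thomson's principle with a trial flow gives `c_{n+1} ≤ c_n
- δ c_n²`; Cauchy–Schwarz gives `c_n² ≤ c_{n+1} (c_n + E[ξ] s_n)`; the branching second moment and
Chebyshev's correlation inequality give `s_{n+1} ≤ m⁻¹ s_n c_{n+1} / c_n + κ c_{n+1}²`. By
`exists_decay_bounds`, `c_n = O(1/n)`, `s_n = O(c_n²)` and `c_n / c_{n+1} ≤ 1 + O(c_n)`.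

Now average over level `j` the conductances of height about `j³` of the subtrees rooted there.
Divided by its mean, this average differs from the normalized size of level `j` by `O(m^{-j})` in
squared L² distance, hence tends to `W` almost surely. The edges of the first `j` levels lower the
conductance by an amount whose expectation, relative to the mean, is `O(j / j³)`, which is summable.
This yields the limit along heights of the form `j³ + j` (up to a fixed shift); monotonicity in the
height fills the gaps, because consecutive means have ratio tending to `1`. -/

/-! ### Marked trees and the recursion for the conductance -/

/-- Offspring numbers and marks of all words. The mark of a word is carried by the edge that joins
it to its parent; the mark of the root plays the role of an edge above the root. -/
abbrev MarkedTree := (List ℕ → ℕ) × (List ℕ → ℝ≥0)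

namespace MarkedTree

/-- The marked subtree of descendants of the `i`-th child of the root. -/
def sub (i : ℕ) (τ : MarkedTree) : MarkedTree := (fun u => τ.1 (i :: u), fun u => τ.2 (i :: u))

@[simp] theorem sub_snd (i : ℕ) (τ : MarkedTree) (u : List ℕ) : (τ.sub i).2 u = τ.2 (i :: u) := rfl

/-- All vertices have children and all edges have positive marks. -/
def Good (τ : MarkedTree) : Prop := (∀ u, 0 < τ.1 u) ∧ ∀ u, u ≠ [] → 0 < τ.2 u

theorem Good.sub {τ : MarkedTree} (h : τ.Good) (i : ℕ) : (τ.sub i).Good :=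
  ⟨fun _ => h.1 _, fun _ _ => h.2 _ (by simp)⟩

theorem Good.mark_pos {τ : MarkedTree} (h : τ.Good) (i : ℕ) : 0 < (τ.sub i).2 [] :=
  h.2 _ (by simp)

/-- The effective resistance between the root and the level `n`, computed recursively. -/
noncomputable def res (m : ℝ≥0) : ℕ → MarkedTree → ℝ≥0
  | 0, _ => 0
  | n + 1, τ => m * (∑ i ∈ Finset.range (τ.1 []), ((τ.sub i).2 [] + res m n (τ.sub i))⁻¹)⁻¹

/-- The sum of the values of `f` at the subtrees of the children of the root, divided by `m`. -/
noncomputable def childMean (m : ℝ≥0) (f : MarkedTree → ℝ≥0∞) (τ : MarkedTree) : ℝ≥0∞ :=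
  (m : ℝ≥0∞)⁻¹ * ∑ i ∈ Finset.range (τ.1 []), f (τ.sub i)

/-- The conductance of a conductor `f τ` in series with the edge above the root. -/
noncomputable def inSeries (f : MarkedTree → ℝ≥0∞) (τ : MarkedTree) : ℝ≥0∞ :=
  ((τ.2 [] : ℝ≥0∞) + (f τ)⁻¹)⁻¹

/-- The effective conductance between the root and the level `n`, computed recursively. -/
noncomputable def cond (m : ℝ≥0) : ℕ → MarkedTree → ℝ≥0∞
  | 0 => fun _ => ⊤
  | n + 1 => childMean m (inSeries (cond m n))

theorem cond_succ (m : ℝ≥0) (n : ℕ) : cond m (n + 1) = childMean m (inSeries (cond m n)) := rfl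

theorem Good.sum_pos {τ : MarkedTree} (h : τ.Good) {f : ℕ → ℝ≥0} (hf : ∀ i, 0 < f i) :
    0 < ∑ i ∈ Finset.range (τ.1 []), f i :=
  Finset.sum_pos (fun i _ => hf i) ⟨0, Finset.mem_range.2 (h.1 [])⟩

/-- Goodness makes every branch resistance and every sum of branch conductances nonzero, so
inversion in `ℝ≥0`, where `0⁻¹ = 0`, agrees with inversion in `ℝ≥0∞`, where `0⁻¹ = ⊤`. -/
theorem cond_eq_inv_res {m : ℝ≥0} (hm : 0 < m) (n : ℕ) {τ : MarkedTree} (h : τ.Good) :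
    cond m n τ = (res m n τ : ℝ≥0∞)⁻¹ := by
  induction n generalizing τ with
  | zero => simp [cond, res]
  | succ n ih =>
    have hpos : ∀ i, 0 < (τ.sub i).2 [] + res m n (τ.sub i) :=
      fun i => add_pos_of_pos_of_nonneg (h.mark_pos i) zero_le
    have hS := h.sum_pos (fun i => inv_pos.2 (hpos i))
    rw [cond, res, ← ENNReal.coe_inv (mul_pos hm (inv_pos.2 hS)).ne', mul_inv, inv_inv,
      ENNReal.coe_mul, ENNReal.coe_inv hm.ne', childMean, ENNReal.ofNNReal_finsetSum]
    congr 1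
    refine Finset.sum_congr rfl fun i _ => ?_
    rw [inSeries, ih (h.sub i), inv_inv, ENNReal.coe_inv (hpos i).ne', ENNReal.coe_add]

end MarkedTree

/-! ### Words in a planted tree -/

namespace plantedTree

theorem cons_mem {N : List ℕ → ℕ} {i : ℕ} {l : List ℕ} :
    i :: l ∈ plantedTree N ↔ i < N [] ∧ l ∈ plantedTree (fun u => N (i :: u)) := by
  constructor
  · intro h
    exact ⟨h [] i (by simp), fun u j hu => h (i :: u) j (by simpa using hu)⟩
  · rintro ⟨hi, hl⟩ u j hu
    cases u with
    | nil =>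
      obtain rfl : j = i := by simpa using hu
      exact hi
    | cons a u =>
      obtain ⟨rfl, h⟩ : a = i ∧ u ++ [j] <+: l := by simpa using hu
      exact hl u j h

theorem concat_mem {N : List ℕ → ℕ} {u : List ℕ} {i : ℕ} :
    u ++ [i] ∈ plantedTree N ↔ u ∈ plantedTree N ∧ i < N u := by
  constructor
  · intro h
    exact ⟨fun v j hv => h v j (hv.trans (List.prefix_append u [i])), h u i List.prefix_rfl⟩
  · rintro ⟨hu, hi⟩ v j hv
    rcases List.prefix_concat_iff.1 hv with h | h
    · obtain ⟨rfl, hj⟩ := List.append_inj' h rfl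
      obtain rfl : j = i := by simpa using hj
      exact hi
    · exact hu v j h

theorem dropLast_mem {N : List ℕ → ℕ} {x : List ℕ} (hx : x ∈ plantedTree N) :
    x.dropLast ∈ plantedTree N :=
  fun u i h => hx u i (h.trans (List.dropLast_prefix x))

theorem adj_iff {N : List ℕ → ℕ} {x y : plantedTree N} :
    (graph N).Adj x y ↔ (∃ i, y.1 = x.1 ++ [i]) ∨ ∃ i, x.1 = y.1 ++ [i] := by
  rw [graph, SimpleGraph.fromRel_adj, and_iff_right_iff_imp]
  rintro (⟨i, h⟩ | ⟨i, h⟩) rfl <;> simp at h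

/-- The parent of a vertex (the root being its own parent). -/
def parent {N : List ℕ → ℕ} (x : plantedTree N) : plantedTree N :=
  ⟨x.1.dropLast, dropLast_mem x.2⟩

theorem mem_level {N : List ℕ → ℕ} {n : ℕ} {x : plantedTree N} :
    x ∈ level N n ↔ x.1.length = n := by
  simp [level]

/-- A sum over the neighbours of `x` is a sum over its children and its parent. -/
theorem sum_neighborFinset {N : List ℕ → ℕ} (x : plantedTree N) (h : List ℕ → ℝ) :
    ∑ y ∈ (graph N).neighborFinset x, h y.1 =
      ∑ i ∈ Finset.range (N x.1), h (x.1 ++ [i]) + if x.1 = [] then 0 else h x.1.dropLast := by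
  have key : ((graph N).neighborFinset x).map ⟨Subtype.val, Subtype.val_injective⟩ =
      (Finset.range (N x.1)).image (fun i => x.1 ++ [i]) ∪
        if x.1 = [] then ∅ else {x.1.dropLast} := by
    ext y
    simp only [Finset.mem_map, SimpleGraph.mem_neighborFinset, adj_iff,
      Function.Embedding.coeFn_mk, Finset.mem_union, Finset.mem_image, Finset.mem_range]
    constructor
    · rintro ⟨y, ⟨i, hi⟩ | ⟨i, hi⟩, rfl⟩
      · exact Or.inl ⟨i, (concat_mem.1 (hi ▸ y.2)).2, hi.symm⟩
      · right
        simp [hi]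
    · rintro (⟨i, hi, rfl⟩ | hy)
      · exact ⟨⟨_, concat_mem.2 ⟨x.2, hi⟩⟩, Or.inl ⟨i, rfl⟩, rfl⟩
      · split_ifs at hy with hx
        · simp at hy
        · rw [Finset.mem_singleton] at hy
          subst hy
          exact ⟨parent x, Or.inr ⟨_, (List.dropLast_concat_getLast hx).symm⟩, rfl⟩
  have : ∑ y ∈ (graph N).neighborFinset x, h y.1 =
      ∑ y ∈ ((graph N).neighborFinset x).map ⟨Subtype.val, Subtype.val_injective⟩, h y := by
    rw [Finset.sum_map]; rfl
  rw [this, key, Finset.sum_union, Finset.sum_image (by intro i _ j _ h; simpa using h)]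
  · congr 1
    split_ifs <;> simp
  · rw [Finset.disjoint_left]
    intro y hy hy'
    split_ifs at hy' with hx
    · simp at hy'
    · obtain ⟨i, -, rfl⟩ := Finset.mem_image.1 hy
      rw [Finset.mem_singleton] at hy'
      have := congrArg List.length hy'
      simp at this
      lia

/-- A sum over the level `n + 1` is a sum over the levels `n` of the subtrees. -/
theorem sum_level_succ {M : Type*} [AddCommMonoid M] (N : List ℕ → ℕ) (n : ℕ) (h : List ℕ → M) :
    ∑ z ∈ level N (n + 1), h z.1 =
      ∑ i ∈ Finset.range (N []), ∑ z ∈ level (fun u => N (i :: u)) n, h (i :: z.1) := by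
  rw [Finset.sum_sigma']
  symm
  refine Finset.sum_bij' (s := (Finset.range (N [])).sigma
    fun i => level (fun u => N (i :: u)) n) (t := level N (n + 1))
    (fun p hp => ⟨p.1 :: p.2.1, cons_mem.2
      ⟨Finset.mem_range.1 (Finset.mem_sigma.1 hp).1, p.2.2⟩⟩)
    (fun z hz => ⟨z.1.head (by rintro h0; simp [mem_level, h0] at hz), ⟨z.1.tail, by
      have h0 : z.1 ≠ [] := by rintro h0; simp [mem_level, h0] at hz
      have := z.2
      rw [← List.cons_head_tail h0] at this
      exact (cons_mem.1 this).2⟩⟩) ?_ ?_ ?_ ?_ ?_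
  · intro p hp
    have := (Finset.mem_sigma.1 hp).2
    simpa [mem_level] using this
  · intro z hz
    have h0 : z.1 ≠ [] := by rintro h0; simp [mem_level, h0] at hz
    have := z.2
    rw [← List.cons_head_tail h0] at this
    rw [mem_level] at hz
    simp [mem_level, hz, (cons_mem.1 this).1]
  · intro p hp
    simp
  · intro z hz
    simp
  · intro p hp
    simp

theorem level_zero (N : List ℕ → ℕ) : level N 0 = {root N} := by
  ext x
  rw [mem_level, List.length_eq_zero_iff, Finset.mem_singleton, root, Subtype.ext_iff]

end plantedTree

/-! ### The effective conductance of a planted tree satisfies the recursion -/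

/-- Splitting words by their first letter is what decomposes the energy of a flow over the subtrees
of the children. -/
theorem ENNReal.tsum_list {α : Type*} (f : List α → ℝ≥0∞) :
    ∑' x, f x = f [] + ∑' a, ∑' l, f (a :: l) := by
  rw [ENNReal.tsum_eq_add_tsum_ite []]
  congr 1
  rw [← ENNReal.tsum_prod (f := fun a l => f (a :: l))]
  have hinj : Function.Injective (fun p : α × List α => p.1 :: p.2) := by
    rintro ⟨a, l⟩ ⟨b, k⟩ h
    simpa using h
  rw [← hinj.tsum_eq]
  · simp
  · intro x hx
    cases x with
    | nil => simp at hx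
    | cons a l => exact ⟨(a, l), rfl⟩

namespace MarkedTree

open plantedTree

open Classical in
/-- The energy of a flow in a marked tree, where `g x` is the flow from the parent of `x` to `x`. -/
noncomputable def treeEnergy (m : ℝ≥0) (τ : MarkedTree) (g : List ℕ → ℝ) : ℝ≥0∞ :=
  ∑' x : List ℕ, if x ∈ plantedTree τ.1 ∧ x ≠ [] then
    ((m ^ x.length * τ.2 x : ℝ≥0) : ℝ≥0∞) * ENNReal.ofReal (g x ^ 2) else 0

/-- The factor `m` appears because each vertex lies one level deeper in the tree than in its
subtree. -/
theorem treeEnergy_eq_sum (m : ℝ≥0) (τ : MarkedTree) (g : List ℕ → ℝ) :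
    treeEnergy m τ g = ∑ i ∈ Finset.range (τ.1 []), m *
      ((τ.sub i).2 [] * ENNReal.ofReal (g [i] ^ 2) +
        treeEnergy m (τ.sub i) (fun l => g (i :: l))) := by
  classical
  rw [treeEnergy, ENNReal.tsum_list, tsum_eq_sum (s := Finset.range (τ.1 []))]
  · simp only [ne_eq, not_true_eq_false, and_false, if_false, zero_add]
    refine Finset.sum_congr rfl fun i hi => ?_
    rw [treeEnergy, mul_add, ← ENNReal.tsum_mul_left, ENNReal.tsum_list,
      ENNReal.tsum_list (fun x => (m : ℝ≥0∞) * _)]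
    simp only [ne_eq, not_true_eq_false, and_false, if_false, mul_zero, zero_add, cons_mem,
      Finset.mem_range.1 hi, true_and, reduceCtorEq, not_false_eq_true, and_true]
    congr 1
    · rw [if_pos (nil_mem _)]
      simp [mul_assoc]
    · refine tsum_congr fun a => tsum_congr fun l => ?_
      rw [mul_ite, mul_zero, ← mul_assoc, ← ENNReal.coe_mul, List.length_cons, pow_succ', mul_assoc]
      rfl
  · intro i hi
    rw [Finset.mem_range] at hi
    simp [cons_mem, hi]

theorem treeEnergy_const_mul (m : ℝ≥0) (τ : MarkedTree) (g : List ℕ → ℝ) (c : ℝ) :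
    treeEnergy m τ (fun x => c * g x) = ENNReal.ofReal (c ^ 2) * treeEnergy m τ g := by
  rw [treeEnergy, treeEnergy, ← ENNReal.tsum_mul_left]
  refine tsum_congr fun x => ?_
  split_ifs
  · rw [mul_pow, ENNReal.ofReal_mul (sq_nonneg c)]
    ring
  · simp

/-- The node law strictly above the level `n`. -/
def NodeLaw (n : ℕ) (N : List ℕ → ℕ) (g : List ℕ → ℝ) : Prop :=
  ∀ x ∈ plantedTree N, x.length < n → g x = ∑ i ∈ Finset.range (N x), g (x ++ [i])

/-- **Thomson's principle** on a marked tree. -/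
theorem res_mul_sq_le_treeEnergy (m : ℝ≥0) (n : ℕ) {τ : MarkedTree} (h : τ.Good)
    {g : List ℕ → ℝ} (hg : NodeLaw n τ.1 g) :
    (res m n τ : ℝ≥0∞) * ENNReal.ofReal (g [] ^ 2) ≤ treeEnergy m τ g := by
  induction n generalizing τ g with
  | zero => simp [res]
  | succ n ih =>
    have hsub : ∀ i ∈ Finset.range (τ.1 []),
        NodeLaw n (τ.sub i).1 (fun l => g (i :: l)) := fun i hi x hx hl =>
      hg (i :: x) (cons_mem.2 ⟨Finset.mem_range.1 hi, hx⟩) (by simpa using hl)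
    have hpos : ∀ i, 0 < (τ.sub i).2 [] + res m n (τ.sub i) :=
      fun i => add_pos_of_pos_of_nonneg (h.mark_pos i) zero_le
    have hroot : g [] = ∑ i ∈ Finset.range (τ.1 []), g [i] := hg [] (nil_mem _) (by simp)
    -- Cauchy–Schwarz weighted by the branch conductances: dividing the flow among the children
    -- costs least when the shares are proportional to them.
    have hcs := Finset.sq_sum_div_le_sum_sq_div (Finset.range (τ.1 [])) (fun i => g [i])
      (g := fun i => ((((τ.sub i).2 [] + res m n (τ.sub i))⁻¹ : ℝ≥0) : ℝ))
      (fun i _ => by exact_mod_cast inv_pos.2 (hpos i))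
    rw [← hroot] at hcs
    calc (res m (n + 1) τ : ℝ≥0∞) * ENNReal.ofReal (g [] ^ 2)
        = ENNReal.ofReal (m * (g [] ^ 2 / ∑ i ∈ Finset.range (τ.1 []),
            ((((τ.sub i).2 [] + res m n (τ.sub i))⁻¹ : ℝ≥0) : ℝ))) := by
          rw [res, ← ENNReal.ofReal_coe_nnreal, ← ENNReal.ofReal_mul (by positivity)]
          congr 1
          push_cast
          ring
      _ ≤ ENNReal.ofReal (m * ∑ i ∈ Finset.range (τ.1 []),
            g [i] ^ 2 / ((((τ.sub i).2 [] + res m n (τ.sub i))⁻¹ : ℝ≥0) : ℝ)) := by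
          gcongr
      _ = ∑ i ∈ Finset.range (τ.1 []), m * ((τ.sub i).2 [] * ENNReal.ofReal (g [i] ^ 2) +
            res m n (τ.sub i) * ENNReal.ofReal (g [i] ^ 2)) := by
          rw [Finset.mul_sum, ENNReal.ofReal_sum_of_nonneg (fun i _ => by positivity)]
          refine Finset.sum_congr rfl fun i _ => ?_
          rw [← add_mul, ← ENNReal.coe_add, ← ENNReal.ofReal_coe_nnreal (p := _ + _),
            ← ENNReal.ofReal_mul (by positivity), ← ENNReal.ofReal_coe_nnreal (p := m),
            ← ENNReal.ofReal_mul (by positivity)]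
          congr 1
          push_cast
          rw [div_inv_eq_mul]
          ring
      _ ≤ _ := by
          rw [treeEnergy_eq_sum]
          refine Finset.sum_le_sum fun i hi => ?_
          gcongr
          exact ih (h.sub i) (hsub i hi)

/-- The unit flow of least energy from the root to the level `n`. -/
noncomputable def unitFlow (m : ℝ≥0) : ℕ → MarkedTree → List ℕ → ℝ
  | _, _, [] => 1
  | 0, _, _ :: _ => 0
  | n + 1, τ, i :: l =>
    ((((τ.sub i).2 [] + res m n (τ.sub i))⁻¹ /
      ∑ j ∈ Finset.range (τ.1 []), ((τ.sub j).2 [] + res m n (τ.sub j))⁻¹ : ℝ≥0) : ℝ) *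
      unitFlow m n (τ.sub i) l

@[simp] theorem unitFlow_nil (m : ℝ≥0) (n : ℕ) (τ : MarkedTree) : unitFlow m n τ [] = 1 := by
  cases n <;> rfl

theorem unitFlow_eq_zero (m : ℝ≥0) (n : ℕ) (τ : MarkedTree) {x : List ℕ} (hx : n < x.length) :
    unitFlow m n τ x = 0 := by
  induction n generalizing τ x with
  | zero =>
    cases x with
    | nil => simp at hx
    | cons i l => rfl
  | succ n ih =>
    cases x with
    | nil => simp at hx
    | cons i l => rw [unitFlow, ih _ (by simpa using hx), mul_zero]

theorem sum_unitFlow_weight (m : ℝ≥0) (n : ℕ) {τ : MarkedTree} (h : τ.Good) :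
    ∑ i ∈ Finset.range (τ.1 []), ((((τ.sub i).2 [] + res m n (τ.sub i))⁻¹ /
      ∑ j ∈ Finset.range (τ.1 []), ((τ.sub j).2 [] + res m n (τ.sub j))⁻¹ : ℝ≥0) : ℝ) = 1 := by
  rw [← NNReal.coe_sum, ← Finset.sum_div, div_self, NNReal.coe_one]
  exact (h.sum_pos fun i => inv_pos.2 (add_pos_of_pos_of_nonneg (h.mark_pos i) zero_le)).ne'

theorem nodeLaw_unitFlow (m : ℝ≥0) (n : ℕ) {τ : MarkedTree} (h : τ.Good) :
    NodeLaw n τ.1 (unitFlow m n τ) := by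
  induction n generalizing τ with
  | zero => intro x _ hx; simp at hx
  | succ n ih =>
    intro x hx hl
    cases x with
    | nil =>
      simp only [unitFlow_nil, List.nil_append, unitFlow, mul_one]
      exact (sum_unitFlow_weight m n h).symm
    | cons i l =>
      simp only [List.cons_append, unitFlow]
      rw [ih (h.sub i) l (cons_mem.1 hx).2 (by simpa using hl), Finset.mul_sum]
      rfl

theorem sum_level_unitFlow (m : ℝ≥0) (n : ℕ) {τ : MarkedTree} (h : τ.Good) :
    ∑ z ∈ level τ.1 n, unitFlow m n τ z.1 = 1 := by
  induction n generalizing τ with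
  | zero => simp [level_zero, root]
  | succ n ih =>
    rw [sum_level_succ, ← sum_unitFlow_weight m n h]
    refine Finset.sum_congr rfl fun i _ => ?_
    simp only [unitFlow]
    rw [← Finset.mul_sum]
    exact (congrArg _ (ih (h.sub i))).trans (mul_one _)

/-- The equality case of Cauchy–Schwarz: with branch conductances `w_i` of sum `S`, the share `w_i /
S` costs `w_i⁻¹ (w_i / S)² = w_i / S²`, and these costs add up to `1 / S`. -/
theorem treeEnergy_unitFlow (m : ℝ≥0) (n : ℕ) {τ : MarkedTree} (h : τ.Good) :
    treeEnergy m τ (unitFlow m n τ) = res m n τ := by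
  induction n generalizing τ with
  | zero =>
    rw [treeEnergy, res, ENNReal.coe_zero, ENNReal.tsum_eq_zero]
    rintro (_ | ⟨i, l⟩) <;> simp [unitFlow]
  | succ n ih =>
    have hpos : ∀ i, 0 < (τ.sub i).2 [] + res m n (τ.sub i) :=
      fun i => add_pos_of_pos_of_nonneg (h.mark_pos i) zero_le
    have hS := h.sum_pos (fun i => inv_pos.2 (hpos i))
    rw [treeEnergy_eq_sum, res]
    set S := ∑ i ∈ Finset.range (τ.1 []), ((τ.sub i).2 [] + res m n (τ.sub i))⁻¹ with hSdef
    have : ∀ i ∈ Finset.range (τ.1 []), (m : ℝ≥0∞) *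
        ((τ.sub i).2 [] * ENNReal.ofReal (unitFlow m (n + 1) τ [i] ^ 2) +
          treeEnergy m (τ.sub i) (fun l => unitFlow m (n + 1) τ (i :: l))) =
        ((m * ((τ.sub i).2 [] + res m n (τ.sub i))⁻¹ * (S⁻¹ * S⁻¹) : ℝ≥0) : ℝ≥0∞) := by
      intro i _
      simp only [unitFlow]
      rw [treeEnergy_const_mul, ih (h.sub i), mul_one, ← NNReal.coe_pow,
        ENNReal.ofReal_coe_nnreal]
      norm_cast
      rw [← hSdef]
      have := (hpos i).ne'
      field_simp
    rw [Finset.sum_congr rfl this, ← ENNReal.ofNNReal_finsetSum, ← Finset.sum_mul,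
      ← Finset.mul_sum, ← hSdef]
    congr 1
    field_simp

end MarkedTree

/-! ### Flows on the tree graph, encoded by their inflows. -/

namespace plantedTree

open MarkedTree

variable {N : List ℕ → ℕ}

open Classical in
/-- The flow from the parent of `x` to `x`, extended by `0` to words that are not vertices. -/
noncomputable def inflow (θ : NetworkFlow (plantedTree N)) (x : List ℕ) : ℝ :=
  if h : x ∈ plantedTree N then θ.toFun (parent ⟨x, h⟩) ⟨x, h⟩ else 0

theorem inflow_of_mem (θ : NetworkFlow (plantedTree N)) (x : plantedTree N) :
    inflow θ x.1 = θ.toFun (parent x) x :=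
  dif_pos x.2

theorem div_eq (θ : NetworkFlow (plantedTree N)) (x : plantedTree N) :
    θ.div (graph N) x = ∑ i ∈ Finset.range (N x.1), inflow θ (x.1 ++ [i]) -
      if x.1 = [] then 0 else inflow θ x.1 := by
  classical
  have := sum_neighborFinset x (fun y => if h : y ∈ plantedTree N then θ.toFun x ⟨y, h⟩ else 0)
  simp only [Subtype.coe_eta, Subtype.coe_prop, dite_true] at this
  rw [NetworkFlow.div, this, sub_eq_add_neg]
  congr 1
  · refine Finset.sum_congr rfl fun i hi => ?_
    have hmem : x.1 ++ [i] ∈ plantedTree N := concat_mem.2 ⟨x.2, Finset.mem_range.1 hi⟩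
    rw [dif_pos hmem, inflow, dif_pos hmem]
    congr 1
    simp [parent]
  · split_ifs with h
    · simp
    · rw [inflow_of_mem, θ.antisymm]
      rfl
    · exact absurd (dropLast_mem x.2) (by assumption)

/-- Vertices other than the root correspond to edges. -/
noncomputable def edgeEquiv (N : List ℕ → ℕ) :
    {x : List ℕ | x ∈ plantedTree N ∧ x ≠ []} ≃ (graph N).edgeSet :=
  Equiv.ofBijective
    (fun x => ⟨s(parent ⟨x.1, x.2.1⟩, ⟨x.1, x.2.1⟩), by
      rw [SimpleGraph.mem_edgeSet, adj_iff]
      exact Or.inl ⟨_, (List.dropLast_concat_getLast x.2.2).symm⟩⟩) <| by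
    constructor
    · rintro ⟨x, hx, hx0⟩ ⟨y, hy, hy0⟩ h
      rw [Subtype.mk.injEq, Sym2.eq_iff] at h
      rcases h with ⟨-, h⟩ | ⟨h1, h2⟩
      · simpa using h
      · have h1 := congrArg (fun z => z.1.length) h1
        have h2 := congrArg (fun z => z.1.length) h2
        simp only [parent, List.length_dropLast] at h1 h2
        have := List.length_pos_iff.2 hx0
        lia
    · rintro ⟨e, he⟩
      induction e using Sym2.ind with
      | _ x y =>
        rw [SimpleGraph.mem_edgeSet, adj_iff] at he
        rcases he with ⟨i, hi⟩ | ⟨i, hi⟩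
        · refine ⟨⟨y.1, y.2, by simp [hi]⟩, ?_⟩
          rw [Subtype.mk.injEq]
          congr 1
          simp [parent, hi]
        · refine ⟨⟨x.1, x.2, by simp [hi]⟩, ?_⟩
          rw [Subtype.mk.injEq, Sym2.eq_swap]
          congr 1
          simp [parent, hi]

theorem energy_eq (m : ℝ≥0) (τ : MarkedTree) (θ : NetworkFlow (plantedTree τ.1)) :
    θ.energy (graph τ.1) (resistance m τ.1 τ.2) = treeEnergy m τ (inflow θ) := by
  classical
  rw [NetworkFlow.energy, ← (edgeEquiv τ.1).tsum_eq, treeEnergy]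
  have := tsum_subtype {x : List ℕ | x ∈ plantedTree τ.1 ∧ x ≠ []} (fun x =>
    ((m ^ x.length * τ.2 x : ℝ≥0) : ℝ≥0∞) * ENNReal.ofReal (inflow θ x ^ 2))
  simp only [Set.indicator, Set.mem_ofPred_eq] at this
  rw [← this]
  refine tsum_congr fun x => ?_
  have hlen : (parent ⟨x.1, x.2.1⟩).1.length < x.1.length := by
    simp only [parent, List.length_dropLast]
    have := List.length_pos_iff.2 x.2.2
    lia
  have hr : resistance m τ.1 τ.2 (edgeEquiv τ.1 x) = m ^ x.1.length * τ.2 x.1 := if_pos hlen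
  rw [hr, inflow, dif_pos x.2.1]
  rfl

open Classical in
/-- The flow with given inflows. -/
noncomputable def flowOfInflow (N : List ℕ → ℕ) (g : List ℕ → ℝ) :
    NetworkFlow (plantedTree N) where
  toFun x y := if ∃ i, y.1 = x.1 ++ [i] then g y.1
    else if ∃ i, x.1 = y.1 ++ [i] then -g x.1 else 0
  antisymm x y := by
    by_cases h1 : ∃ i, y.1 = x.1 ++ [i]
    · have h2 : ¬∃ i, x.1 = y.1 ++ [i] := by
        rintro ⟨i, hi⟩
        obtain ⟨j, hj⟩ := h1
        rw [hj] at hi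
        simp at hi
      rw [if_pos h1, if_neg h2, if_pos h1, neg_neg]
    · by_cases h2 : ∃ i, x.1 = y.1 ++ [i]
      · rw [if_neg h1, if_pos h2, if_pos h2]
      · rw [if_neg h1, if_neg h2, if_neg h2, if_neg h1, neg_zero]

theorem inflow_flowOfInflow (g : List ℕ → ℝ) {x : List ℕ} (hx : x ∈ plantedTree N)
    (h0 : x ≠ []) : inflow (flowOfInflow N g) x = g x := by
  rw [inflow, dif_pos hx, flowOfInflow]
  exact if_pos ⟨_, (List.dropLast_concat_getLast h0).symm⟩

theorem div_flowOfInflow (g : List ℕ → ℝ) (x : plantedTree N) :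
    (flowOfInflow N g).div (graph N) x = ∑ i ∈ Finset.range (N x.1), g (x.1 ++ [i]) -
      if x.1 = [] then 0 else g x.1 := by
  rw [div_eq]
  congr 1
  · exact Finset.sum_congr rfl fun i hi => inflow_flowOfInflow g
      (concat_mem.2 ⟨x.2, Finset.mem_range.1 hi⟩) (by simp)
  · split_ifs with h
    · rfl
    · exact inflow_flowOfInflow g x.2 h

theorem sum_source {A : Finset (plantedTree N)} (hA : A = {root N})
    {_ : DecidablePred fun y => y ∉ A} (θ : NetworkFlow (plantedTree N)) :
    ∑ a ∈ A, ∑ y ∈ (graph N).neighborFinset a with y ∉ A, θ.toFun a y =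
      θ.div (graph N) (root N) := by
  rw [Finset.sum_congr hA fun _ _ => rfl, Finset.sum_singleton, NetworkFlow.div,
    Finset.filter_true_of_mem]
  intro y hy
  rw [SimpleGraph.mem_neighborFinset] at hy
  rw [hA, Finset.mem_singleton]
  exact hy.ne'

theorem sum_sink (n : ℕ) [DecidablePred fun y => y ∉ level N n]
    (θ : NetworkFlow (plantedTree N)) :
    ∑ z ∈ level N n, ∑ y ∈ (graph N).neighborFinset z with y ∉ level N n,
      θ.toFun y z = -∑ z ∈ level N n, θ.div (graph N) z := by
  rw [← Finset.sum_neg_distrib]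
  refine Finset.sum_congr rfl fun z hz => ?_
  rw [NetworkFlow.div, Finset.filter_true_of_mem, ← Finset.sum_neg_distrib]
  · exact Finset.sum_congr rfl fun y _ => θ.antisymm y z
  · intro y hy
    rw [mem_level] at hz ⊢
    rw [SimpleGraph.mem_neighborFinset, adj_iff] at hy
    rcases hy with ⟨i, hi⟩ | ⟨i, hi⟩
    · rw [hi, List.length_append, hz]; simp
    · rw [← hz, hi, List.length_append]; simp

/-- The flow `unitFlow` attains the value and Thomson's principle bounds every competitor. For `n =
0` source and sink coincide, no unit flow exists and the effective resistance is `⊤`, whereas `res`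
is `0`. -/
theorem effectiveResistance_eq (m : ℝ≥0) {n : ℕ} (hn : n ≠ 0) {τ : MarkedTree} (h : τ.Good) :
    effectiveResistance (graph τ.1) (resistance m τ.1 τ.2) {root τ.1} (level τ.1 n) =
      res m n τ := by
  classical
  apply le_antisymm
  · refine iInf₂_le_of_le (flowOfInflow τ.1 (unitFlow m n τ)) ⟨?_, ?_, ?_⟩ ?_
    · intro x hx hxn
      rw [Finset.mem_singleton, root, Subtype.ext_iff] at hx
      rw [mem_level] at hxn
      rw [div_flowOfInflow, if_neg hx]
      rcases lt_or_gt_of_ne hxn with hl | hl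
      · rw [nodeLaw_unitFlow m n h x.1 x.2 hl, sub_self]
      · rw [unitFlow_eq_zero _ _ _ hl, Finset.sum_eq_zero, sub_zero]
        exact fun i _ => unitFlow_eq_zero _ _ _ (by rw [List.length_append]; lia)
    · rw [sum_source rfl, div_flowOfInflow, if_pos (show (root τ.1).1 = [] from rfl), sub_zero]
      exact (nodeLaw_unitFlow m n h [] (nil_mem _) (Nat.pos_of_ne_zero hn)).symm.trans
        (unitFlow_nil _ _ _)
    · rw [sum_sink, ← Finset.sum_neg_distrib, ← sum_level_unitFlow m n h]
      refine Finset.sum_congr rfl fun z hz => ?_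
      rw [mem_level] at hz
      rw [div_flowOfInflow, if_neg (by rintro h0; rw [h0] at hz; exact hn hz.symm),
        Finset.sum_eq_zero, zero_sub, neg_neg]
      exact fun i _ => unitFlow_eq_zero _ _ _ (by rw [List.length_append, hz]; simp)
    · rw [energy_eq, ← treeEnergy_unitFlow m n h]
      refine ENNReal.tsum_le_tsum fun x => ?_
      split_ifs with hx
      · rw [inflow_flowOfInflow _ hx.1 hx.2]
      · rfl
  · refine le_iInf₂ fun θ hθ => ?_
    rw [energy_eq]
    -- An inflow of `1` into the empty word encodes the unit source, so that the node law also holds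
    -- at the root.
    set g : List ℕ → ℝ := fun x => if x = [] then 1 else inflow θ x with hg
    have hnode : NodeLaw n τ.1 g := by
      intro x hx hl
      have hdiv := div_eq θ ⟨x, hx⟩
      by_cases h0 : x = []
      · subst h0
        have := hθ.source
        rw [sum_source rfl] at this
        rw [show (⟨[], hx⟩ : plantedTree τ.1) = root τ.1 from rfl, this] at hdiv
        simpa [hg, root] using hdiv
      · rw [hθ.node_law, if_neg h0, eq_comm, sub_eq_zero] at hdiv
        · simpa [hg, h0] using hdiv.symm
        · simpa [root] using h0
        · rw [mem_level]; exact hl.ne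
    have := res_mul_sq_le_treeEnergy m n h hnode
    simp only [hg, if_true, one_pow, ENNReal.ofReal_one, mul_one] at this
    refine this.trans (ENNReal.tsum_le_tsum fun x => ?_)
    split_ifs with hx
    · simp [hx.2]
    · rfl

theorem conductance_eq_cond {m : ℝ≥0} (hm : 0 < m) {n : ℕ} (hn : n ≠ 0) {τ : MarkedTree}
    (h : τ.Good) : conductance m τ.1 τ.2 n = cond m n τ := by
  rw [conductance, effectiveConductance, effectiveResistance_eq m hn h, cond_eq_inv_res hm n h]

/-- This puts level sizes and conductances under the same operator `childMean`, so that both can be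
compared in L². -/
theorem normalizedSize_eq {m : ℝ≥0} (hm : 0 < m) (n : ℕ) (τ : MarkedTree) :
    (normalizedSize m τ.1 n : ℝ≥0∞) = (childMean m)^[n] 1 τ := by
  induction n generalizing τ with
  | zero => simp [normalizedSize, level_zero]
  | succ n ih =>
    have hcard : ((level τ.1 (n + 1)).card : ℝ≥0) =
        ∑ i ∈ Finset.range (τ.1 []), ((level (τ.sub i).1 n).card : ℝ≥0) := by
      have := sum_level_succ τ.1 n (fun _ => (1 : ℝ≥0))
      simpa [MarkedTree.sub] using this
    rw [Function.iterate_succ_apply', childMean, ← Finset.sum_congr rfl fun i _ => ih (τ.sub i),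
      normalizedSize, hcard, ← ENNReal.ofNNReal_finsetSum, ← ENNReal.coe_inv hm.ne',
      ← ENNReal.coe_mul]
    congr 1
    simp only [normalizedSize]
    rw [← Finset.sum_div, pow_succ]
    field_simp

end plantedTree

/-! ### The branching property -/

theorem ProbabilityTheory.indepFun_infinitePi_of_disjoint {ι α β E : Type*} [MeasurableSpace E]
    (ρ : Measure E) [IsProbabilityMeasure ρ] (f : α → ι) (g : β → ι)
    (hfg : Disjoint (Set.range f) (Set.range g)) :
    IndepFun (fun (ω : ι → E) a => ω (f a)) (fun (ω : ι → E) b => ω (g b))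
      (Measure.infinitePi fun _ => ρ) := by
  have hi : iIndepFun (fun i (ω : ι → E) => ω i) (Measure.infinitePi fun _ => ρ) :=
    iIndepFun_infinitePi (P := fun _ : ι => ρ) (X := fun _ x => x) (fun _ => measurable_id)
  have h := indep_iSup_of_disjoint (fun i => (measurable_pi_apply i).comap_le) hi.iIndep hfg
  rw [IndepFun_iff_Indep]
  refine indep_of_indep_of_le h ?_ ?_
  · rw [MeasurableSpace.pi, MeasurableSpace.comap_iSup]
    refine iSup_le fun a => ?_
    rw [MeasurableSpace.comap_comp]
    exact le_iSup₂_of_le (f a) ⟨a, rfl⟩ le_rfl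
  · rw [MeasurableSpace.pi, MeasurableSpace.comap_iSup]
    refine iSup_le fun a => ?_
    rw [MeasurableSpace.comap_comp]
    exact le_iSup₂_of_le (g a) ⟨a, rfl⟩ le_rfl

section WordIndexed

variable {E : Type*} [MeasurableSpace E] (ρ : Measure E) [IsProbabilityMeasure ρ]

theorem map_cons_infinitePi (i : ℕ) :
    (Measure.infinitePi fun _ : List ℕ => ρ).map (fun ω u => ω (i :: u)) =
      Measure.infinitePi fun _ => ρ :=
  Measure.map_infinitePi_infinitePi_of_inj (P := fun _ : List ℕ => ρ)
    (f := fun u : List ℕ => i :: u) (fun u v h => by simpa using h)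

theorem lintegral_cons_infinitePi (i : ℕ) {f : (List ℕ → E) → ℝ≥0∞} (hf : Measurable f) :
    ∫⁻ ω, f (fun u => ω (i :: u)) ∂Measure.infinitePi (fun _ => ρ) =
      ∫⁻ ω, f ω ∂Measure.infinitePi (fun _ => ρ) := by
  conv_rhs => rw [← map_cons_infinitePi ρ i, lintegral_map hf (by fun_prop)]

theorem lintegral_root_mul_cons_infinitePi (i : ℕ) {g : E → ℝ≥0∞} (hg : Measurable g)
    {f : (List ℕ → E) → ℝ≥0∞} (hf : Measurable f) :
    ∫⁻ ω, g (ω []) * f (fun u => ω (i :: u)) ∂Measure.infinitePi (fun _ => ρ) =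
      (∫⁻ x, g x ∂ρ) * ∫⁻ ω, f ω ∂Measure.infinitePi (fun _ => ρ) := by
  have hind := indepFun_infinitePi_of_disjoint ρ (fun _ : Unit => ([] : List ℕ))
    (fun u : List ℕ => i :: u) (by
      rw [Set.disjoint_left]
      rintro _ ⟨_, rfl⟩ ⟨u, hu⟩
      simp at hu)
  have h := lintegral_mul_eq_lintegral_mul_lintegral_of_indepFun''
    (f := fun ω : List ℕ → E => g (ω [])) (g := fun ω => f (fun u => ω (i :: u)))
    (Measurable.aemeasurable (by fun_prop)) (Measurable.aemeasurable (by fun_prop))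
    (hind.comp (φ := fun x : Unit → E => g (x ())) (ψ := f) (by fun_prop) hf)
  rw [lintegral_cons_infinitePi ρ i hf] at h
  rw [h]
  congr 1
  conv_rhs => rw [← Measure.infinitePi_map_eval (fun _ : List ℕ => ρ) []]
  rw [lintegral_map hg (by fun_prop)]

theorem lintegral_root_mul_cons_mul_cons_infinitePi {i j : ℕ} (hij : i ≠ j) {g : E → ℝ≥0∞}
    (hg : Measurable g) {f h : (List ℕ → E) → ℝ≥0∞} (hf : Measurable f) (hh : Measurable h) :
    ∫⁻ ω, g (ω []) * f (fun u => ω (i :: u)) * h (fun u => ω (j :: u))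
        ∂Measure.infinitePi (fun _ => ρ) =
      (∫⁻ x, g x ∂ρ) * (∫⁻ ω, f ω ∂Measure.infinitePi (fun _ => ρ)) *
        ∫⁻ ω, h ω ∂Measure.infinitePi (fun _ => ρ) := by
  -- `Option (List ℕ)` indexes the root and the words of the `i`-th subtree as a single block,
  -- disjoint from the `j`-th subtree; `lintegral_root_mul_cons_infinitePi` then splits this block.
  have hind := indepFun_infinitePi_of_disjoint ρ
    (fun a : Option (List ℕ) => a.elim ([] : List ℕ) (fun u => i :: u))
    (fun u : List ℕ => j :: u) (by
      rw [Set.disjoint_left]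
      rintro _ ⟨_ | a, rfl⟩ ⟨u, hu⟩
      · simp at hu
      · simp [hij.symm] at hu)
  have key := lintegral_mul_eq_lintegral_mul_lintegral_of_indepFun''
    (f := fun ω : List ℕ → E => g (ω []) * f (fun u => ω (i :: u)))
    (g := fun ω => h (fun u => ω (j :: u)))
    (Measurable.aemeasurable (by fun_prop)) (Measurable.aemeasurable (by fun_prop))
    (hind.comp (φ := fun x : Option (List ℕ) → E => g (x none) * f (fun u => x (some u)))
      (ψ := h) (by fun_prop) hh)
  rw [lintegral_cons_infinitePi ρ j hh, lintegral_root_mul_cons_infinitePi ρ i hg hf] at key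
  exact key

end WordIndexed

/-! ### First and second moments of averages over the children. -/

namespace MarkedTree

/-- The law of a Galton-Watson tree with offspring law `ρ` and i.i.d. marks with law `μ`. -/
noncomputable def law (ρ : Measure ℕ) (μ : Measure ℝ≥0) : Measure MarkedTree :=
  (Measure.infinitePi fun _ => ρ).prod (Measure.infinitePi fun _ => μ)

@[fun_prop]
theorem measurable_sub (i : ℕ) : Measurable (sub i) := by
  unfold sub
  fun_prop

@[fun_prop]
theorem measurable_indicator_root (s : Set ℕ) :
    Measurable fun τ : MarkedTree => s.indicator (1 : ℕ → ℝ≥0∞) (τ.1 []) :=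
  (measurable_of_countable (s.indicator (1 : ℕ → ℝ≥0∞))).comp
    ((measurable_pi_apply []).comp measurable_fst)

/-- The random number of summands becomes a fixed series with indicators depending only on the
offspring of the root, so sums and integrals can be exchanged and independence used term by term. -/
theorem childMean_eq_tsum (m : ℝ≥0) (f : MarkedTree → ℝ≥0∞) (τ : MarkedTree) :
    childMean m f τ =
      (m : ℝ≥0∞)⁻¹ * ∑' i, (Set.Ioi i).indicator 1 (τ.1 []) * f (τ.sub i) := by
  rw [childMean, tsum_eq_sum (s := Finset.range (τ.1 []))]
  · congr 1
    refine Finset.sum_congr rfl fun i hi => ?_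
    rw [Set.indicator_of_mem (show τ.1 [] ∈ Set.Ioi i from Finset.mem_range.1 hi), Pi.one_apply, one_mul]
  · intro i hi
    rw [Set.indicator_of_notMem (by simpa using hi), zero_mul]

@[fun_prop]
theorem measurable_childMean (m : ℝ≥0) {f : MarkedTree → ℝ≥0∞} (hf : Measurable f) :
    Measurable (childMean m f) := by
  have : childMean m f = fun τ =>
      (m : ℝ≥0∞)⁻¹ * ∑' i, (Set.Ioi i).indicator 1 (τ.1 []) * f (τ.sub i) :=
    funext (childMean_eq_tsum m f)
  rw [this]
  fun_prop

@[fun_prop]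
theorem measurable_inSeries {f : MarkedTree → ℝ≥0∞} (hf : Measurable f) :
    Measurable (inSeries f) := by
  unfold inSeries
  fun_prop

@[fun_prop]
theorem measurable_cond (m : ℝ≥0) (n : ℕ) : Measurable (cond m n) := by
  induction n with
  | zero => exact measurable_const
  | succ n ih =>
    rw [cond_succ]
    fun_prop

theorem measurable_iterate_childMean (m : ℝ≥0) (k : ℕ) {f : MarkedTree → ℝ≥0∞}
    (hf : Measurable f) : Measurable ((childMean m)^[k] f) := by
  induction k with
  | zero => exact hf
  | succ k ih =>
    rw [Function.iterate_succ_apply']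
    fun_prop

theorem tsum_lintegral_indicator_Ioi (ρ : Measure ℕ) :
    ∑' i, ∫⁻ n, (Set.Ioi i).indicator 1 n ∂ρ = ∫⁻ n : ℕ, (n : ℝ≥0∞) ∂ρ := by
  rw [← lintegral_tsum fun i => (measurable_of_countable _).aemeasurable]
  refine lintegral_congr fun n => ?_
  rw [tsum_eq_sum (s := Finset.range n)]
  · rw [Finset.sum_congr rfl fun i hi =>
      Set.indicator_of_mem (show n ∈ Set.Ioi i from Finset.mem_range.1 hi) _]
    simp
  · intro i hi
    exact Set.indicator_of_notMem (by simpa using hi) _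

/-- The expected number of ordered pairs of distinct children of the root, divided by `m ^ 2`. -/
noncomputable def pairFactor (m : ℝ≥0) (ρ : Measure ℕ) : ℝ≥0∞ :=
  (m : ℝ≥0∞)⁻¹ * (m : ℝ≥0∞)⁻¹ * ∑' i, ∑' j, if i = j then 0 else
    ∫⁻ n, (Set.Ioi i).indicator 1 n * (Set.Ioi j).indicator 1 n ∂ρ

/-- Restoring the diagonal terms turns the double sum into the second moment. -/
theorem pairFactor_lt_top {m : ℝ≥0} {ρ : Measure ℕ} (hm0 : m ≠ 0) (h2 : ∫⁻ n : ℕ, (n : ℝ≥0∞) ^ 2 ∂ρ < ⊤) :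
    pairFactor m ρ < ⊤ := by
  have hinv : (m : ℝ≥0∞)⁻¹ < ⊤ := by simpa [pos_iff_ne_zero] using hm0
  refine ENNReal.mul_lt_top (ENNReal.mul_lt_top hinv hinv) (lt_of_le_of_lt ?_ h2)
  calc _ ≤ ∑' i, ∑' j, ∫⁻ n, (Set.Ioi i).indicator 1 n * (Set.Ioi j).indicator 1 n ∂ρ := by
        gcongr
        split_ifs
        · exact zero_le
        · rfl
    _ = ∫⁻ n : ℕ, ∑' i, ∑' j, (Set.Ioi i).indicator 1 n * (Set.Ioi j).indicator 1 n ∂ρ := by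
        rw [lintegral_tsum fun i => (measurable_of_countable _).aemeasurable]
        refine tsum_congr fun i => ?_
        rw [lintegral_tsum fun i => (measurable_of_countable _).aemeasurable]
    _ = ∫⁻ n : ℕ, (n : ℝ≥0∞) ^ 2 ∂ρ := by
        refine lintegral_congr fun n => ?_
        have : ∑' i, (Set.Ioi i).indicator (1 : ℕ → ℝ≥0∞) n = n := by
          have := tsum_lintegral_indicator_Ioi (Measure.dirac n)
          simpa using this
        simp_rw [ENNReal.tsum_mul_left, ENNReal.tsum_mul_right]
        rw [this, sq]

section Branching

variable (ρ : Measure ℕ) (μ : Measure ℝ≥0) [IsProbabilityMeasure ρ] [IsProbabilityMeasure μ]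

instance : IsProbabilityMeasure (law ρ μ) := by
  unfold law
  infer_instance

theorem lintegral_root_mul_sub (i : ℕ) (g : ℕ → ℝ≥0∞) {f : MarkedTree → ℝ≥0∞}
    (hf : Measurable f) :
    ∫⁻ τ, g (τ.1 []) * f (τ.sub i) ∂law ρ μ = (∫⁻ n, g n ∂ρ) * ∫⁻ τ, f τ ∂law ρ μ := by
  have hg : Measurable g := measurable_of_countable _
  rw [law, lintegral_prod _ (by fun_prop), lintegral_prod _ (by fun_prop),
    ← lintegral_root_mul_cons_infinitePi ρ i hg (by fun_prop)]
  refine lintegral_congr fun N => ?_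
  refine (lintegral_const_mul (g (N [])) (f := fun ξ : List ℕ → ℝ≥0 => f (sub i (N, ξ)))
    (by fun_prop)).trans ?_
  congr 1
  exact lintegral_cons_infinitePi μ i (f := fun ξ => f (fun u => N (i :: u), ξ)) (by fun_prop)

theorem lintegral_root_mul_sub_mul_sub {i j : ℕ} (hij : i ≠ j) (g : ℕ → ℝ≥0∞)
    {f h : MarkedTree → ℝ≥0∞} (hf : Measurable f) (hh : Measurable h) :
    ∫⁻ τ, g (τ.1 []) * f (τ.sub i) * h (τ.sub j) ∂law ρ μ =
      (∫⁻ n, g n ∂ρ) * (∫⁻ τ, f τ ∂law ρ μ) * ∫⁻ τ, h τ ∂law ρ μ := by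
  have hg : Measurable g := measurable_of_countable _
  rw [law, lintegral_prod _ (by fun_prop), lintegral_prod _ hf.aemeasurable,
    lintegral_prod _ hh.aemeasurable,
    ← lintegral_root_mul_cons_mul_cons_infinitePi ρ hij hg (by fun_prop) (by fun_prop)]
  refine lintegral_congr fun N => ?_
  have := lintegral_root_mul_cons_mul_cons_infinitePi μ hij (g := fun _ => 1) measurable_const
    (f := fun ξ => f (fun u => N (i :: u), ξ)) (h := fun ξ => h (fun u => N (j :: u), ξ))
    (by fun_prop) (by fun_prop)
  simp only [one_mul, lintegral_one, measure_univ] at this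
  simp only [mul_assoc]
  rw [lintegral_const_mul _ (by fun_prop), ← this]
  rfl

variable {ρ μ}
variable {m : ℝ≥0}

/-- The mean over the children preserves expectations. -/
theorem lintegral_childMean (hm0 : m ≠ 0) (hm : ∫⁻ n : ℕ, (n : ℝ≥0∞) ∂ρ = m)
    {f : MarkedTree → ℝ≥0∞} (hf : Measurable f) :
    ∫⁻ τ, childMean m f τ ∂law ρ μ = ∫⁻ τ, f τ ∂law ρ μ := by
  have hmeas : ∀ i, Measurable fun τ : MarkedTree =>
      (Set.Ioi i).indicator (1 : ℕ → ℝ≥0∞) (τ.1 []) * f (τ.sub i) := fun i => by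
    fun_prop
  simp_rw [childMean_eq_tsum]
  rw [lintegral_const_mul _ (Measurable.tsum hmeas),
    lintegral_tsum fun i => (hmeas i).aemeasurable]
  simp_rw [lintegral_root_mul_sub ρ μ _ _ hf]
  rw [ENNReal.tsum_mul_right, tsum_lintegral_indicator_Ioi, hm, ← mul_assoc,
    ENNReal.inv_mul_cancel (by simpa using hm0) ENNReal.coe_ne_top, one_mul]

/-- Expand over pairs of children. The diagonal contributes `m` terms in expectation against `m⁻²`,
hence the decisive factor `m⁻¹`; distinct children carry subtrees independent of each other and of
the offspring number, so the other pairs see only the two means. -/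
theorem lintegral_childMean_mul_childMean (hm0 : m ≠ 0)
    (hm : ∫⁻ n : ℕ, (n : ℝ≥0∞) ∂ρ = m) {f h : MarkedTree → ℝ≥0∞} (hf : Measurable f)
    (hh : Measurable h) :
    ∫⁻ τ, childMean m f τ * childMean m h τ ∂law ρ μ =
      (m : ℝ≥0∞)⁻¹ * ∫⁻ τ, f τ * h τ ∂law ρ μ +
        pairFactor m ρ * ((∫⁻ τ, f τ ∂law ρ μ) * ∫⁻ τ, h τ ∂law ρ μ) := by
  have hmeas : ∀ i j, Measurable fun τ : MarkedTree =>
      ((Set.Ioi i).indicator (1 : ℕ → ℝ≥0∞) (τ.1 []) * f (τ.sub i)) *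
        ((Set.Ioi j).indicator (1 : ℕ → ℝ≥0∞) (τ.1 []) * h (τ.sub j)) := fun i j => by
    fun_prop
  have hterm : ∀ i j, ∫⁻ τ : MarkedTree,
      ((Set.Ioi i).indicator (1 : ℕ → ℝ≥0∞) (τ.1 []) * f (τ.sub i)) *
        ((Set.Ioi j).indicator (1 : ℕ → ℝ≥0∞) (τ.1 []) * h (τ.sub j)) ∂law ρ μ =
      (if j = i then (∫⁻ n, (Set.Ioi i).indicator 1 n ∂ρ) * ∫⁻ τ, f τ * h τ ∂law ρ μ else 0) +
      (if i = j then 0 else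
        ∫⁻ n, (Set.Ioi i).indicator 1 n * (Set.Ioi j).indicator 1 n ∂ρ) *
          ((∫⁻ τ, f τ ∂law ρ μ) * ∫⁻ τ, h τ ∂law ρ μ) := by
    intro i j
    by_cases hij : i = j
    · subst hij
      rw [if_pos rfl, if_pos rfl, zero_mul, add_zero,
        ← lintegral_root_mul_sub ρ μ i _ (f := fun τ => f τ * h τ) (by fun_prop)]
      refine lintegral_congr fun τ => ?_
      by_cases hi : τ.1 [] ∈ Set.Ioi i <;> simp [hi]
    · rw [if_neg (Ne.symm hij), if_neg hij, zero_add, ← mul_assoc,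
        ← lintegral_root_mul_sub_mul_sub ρ μ hij _ hf hh]
      refine lintegral_congr fun τ => ?_
      ring
  have hprod : ∀ τ : MarkedTree, childMean m f τ * childMean m h τ =
      (m : ℝ≥0∞)⁻¹ * (m : ℝ≥0∞)⁻¹ * ∑' i, ∑' j,
        ((Set.Ioi i).indicator (1 : ℕ → ℝ≥0∞) (τ.1 []) * f (τ.sub i)) *
        ((Set.Ioi j).indicator (1 : ℕ → ℝ≥0∞) (τ.1 []) * h (τ.sub j)) := by
    intro τ
    simp_rw [childMean_eq_tsum, ENNReal.tsum_mul_left, ENNReal.tsum_mul_right]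
    ring
  have hinv : (m : ℝ≥0∞)⁻¹ * m = 1 :=
    ENNReal.inv_mul_cancel (by simpa using hm0) ENNReal.coe_ne_top
  simp_rw [hprod]
  rw [lintegral_const_mul _ (Measurable.tsum fun i => Measurable.tsum fun j => hmeas i j),
    lintegral_tsum fun i => (Measurable.tsum fun j => hmeas i j).aemeasurable]
  simp_rw [lintegral_tsum fun j => (hmeas _ j).aemeasurable, hterm, ENNReal.tsum_add, tsum_ite_eq,
    ENNReal.tsum_mul_right]
  rw [tsum_lintegral_indicator_Ioi, hm, mul_add, pairFactor]
  congr 1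
  · rw [mul_assoc, ← mul_assoc _ (m : ℝ≥0∞), hinv, one_mul]
  · ring

end Branching

/-! ### The mark above the root -/

/-- `f` does not depend on the mark of the root. -/
def RootFree {α : Type*} (f : MarkedTree → α) : Prop :=
  ∀ (N : List ℕ → ℕ) (ξ ξ' : List ℕ → ℝ≥0), (∀ u, u ≠ [] → ξ u = ξ' u) → f (N, ξ) = f (N, ξ')

theorem rootFree_childMean (m : ℝ≥0) (f : MarkedTree → ℝ≥0∞) : RootFree (childMean m f) := by
  intro N ξ ξ' h
  have : ∀ i, sub i (N, ξ) = sub i (N, ξ') := fun i =>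
    Prod.ext rfl (funext fun u => h (i :: u) (by simp))
  simp only [childMean, this]

theorem rootFree_cond (m : ℝ≥0) (n : ℕ) : RootFree (cond m n) := by
  cases n with
  | zero => intro _ _ _ _; rfl
  | succ n => exact rootFree_childMean m _

open Classical in
/-- Extend a family of marks by `0` at the root. -/
noncomputable def extendMarks (w : {u : List ℕ // u ≠ []} → ℝ≥0) (u : List ℕ) : ℝ≥0 :=
  if h : u ≠ [] then w ⟨u, h⟩ else 0

theorem extendMarks_of_ne (w : {u : List ℕ // u ≠ []} → ℝ≥0) {u : List ℕ} (h : u ≠ []) :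
    extendMarks w u = w ⟨u, h⟩ := dif_pos h

@[fun_prop]
theorem measurable_extendMarks : Measurable extendMarks := by
  refine measurable_pi_lambda _ fun u => ?_
  by_cases h : u ≠ []
  · simp_rw [extendMarks_of_ne _ h]
    fun_prop
  · simp only [extendMarks, dif_neg h]
    fun_prop

theorem map_restrict_infinitePi (μ : Measure ℝ≥0) [IsProbabilityMeasure μ] :
    (Measure.infinitePi fun _ : List ℕ => μ).map (fun ξ (u : {u : List ℕ // u ≠ []}) => ξ u) =
      Measure.infinitePi fun _ => μ :=
  Measure.map_infinitePi_infinitePi_of_inj (P := fun _ : List ℕ => μ) Subtype.val_injective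

/-- The mark of the root is independent of the rest of the marked tree. -/
theorem lintegral_rootMark (ρ : Measure ℕ) (μ : Measure ℝ≥0) [IsProbabilityMeasure ρ]
    [IsProbabilityMeasure μ] {f : ℝ≥0 → MarkedTree → ℝ≥0∞}
    (hf : Measurable (Function.uncurry f)) (hfree : ∀ x, RootFree (f x)) :
    ∫⁻ τ, f (τ.2 []) τ ∂law ρ μ = ∫⁻ x, ∫⁻ τ, f x τ ∂law ρ μ ∂μ := by
  have hind := indepFun_infinitePi_of_disjoint μ (fun _ : Unit => ([] : List ℕ))
    (fun u : {u : List ℕ // u ≠ []} => u.1) (by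
      rw [Set.disjoint_left]
      rintro _ ⟨_, rfl⟩ ⟨u, hu⟩
      exact u.2 hu)
  have hind' : IndepFun (fun ξ : List ℕ → ℝ≥0 => ξ []) (fun ξ (u : {u : List ℕ // u ≠ []}) => ξ u)
      (Measure.infinitePi fun _ => μ) :=
    hind.comp (φ := fun x : Unit → ℝ≥0 => x ()) (ψ := id)
      (measurable_pi_apply (X := fun _ => ℝ≥0) ()) measurable_id
  have hmap := hind'.map_prod_eq_prod_map_map
    (Measurable.aemeasurable (by fun_prop)) (Measurable.aemeasurable (by fun_prop))
  -- Filling in `0` at the root exhibits `f x` as a function of the marks off the root, which are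
  -- independent of the mark of the root.
  have hext : ∀ x N (ξ : List ℕ → ℝ≥0),
      f x (N, extendMarks fun u : {u : List ℕ // u ≠ []} => ξ u) = f x (N, ξ) :=
    fun x N ξ => hfree x N _ _ fun u hu => extendMarks_of_ne _ hu
  have hmeas : ∀ x, Measurable (f x) := fun x => hf.comp (measurable_const.prodMk measurable_id)
  rw [lintegral_lintegral_swap hf.aemeasurable, law, lintegral_prod _ (by fun_prop),
    lintegral_prod _ (by fun_prop)]
  refine lintegral_congr fun N => ?_
  have h1 : ∫⁻ ξ, f (ξ []) (N, ξ) ∂(Measure.infinitePi fun _ : List ℕ => μ) =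
      ∫⁻ z : ℝ≥0 × ({u : List ℕ // u ≠ []} → ℝ≥0), f z.1 (N, extendMarks z.2)
        ∂(μ.prod (Measure.infinitePi fun _ => μ)) := by
    have hm1 : (Measure.infinitePi fun _ : List ℕ => μ).map (fun ξ => ξ []) = μ :=
      Measure.infinitePi_map_eval (fun _ : List ℕ => μ) []
    have : μ.prod (Measure.infinitePi fun _ : {u : List ℕ // u ≠ []} => μ) =
        (Measure.infinitePi fun _ : List ℕ => μ).map
          (fun ξ => (ξ [], fun u : {u : List ℕ // u ≠ []} => ξ u)) := by
      refine Eq.trans ?_ hmap.symm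
      rw [← map_restrict_infinitePi μ]
      nth_rw 1 [← hm1]
    rw [this, lintegral_map (by fun_prop) (by fun_prop)]
    exact lintegral_congr fun ξ => (hext _ _ _).symm
  rw [h1, lintegral_prod_symm _ (by fun_prop)]
  rw [← map_restrict_infinitePi μ, lintegral_map (by fun_prop) (by fun_prop)]
  exact lintegral_congr fun ξ => lintegral_congr fun x => hext _ _ _

end MarkedTree

/-! ### Moments of the conductance -/

/-- The conductance of a resistance `x` and a conductance `a` in series. -/
noncomputable def seriesCond (x : ℝ≥0) (a : ℝ≥0∞) : ℝ≥0∞ := ((x : ℝ≥0∞) + a⁻¹)⁻¹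

theorem seriesCond_coe (x a : ℝ≥0) : seriesCond x a = ((a / (1 + x * a) : ℝ≥0) : ℝ≥0∞) := by
  rcases eq_or_ne a 0 with rfl | ha
  · simp [seriesCond]
  · rw [seriesCond, ← ENNReal.coe_inv ha, ← ENNReal.coe_add, ← ENNReal.coe_inv]
    · congr 1
      field_simp
      rw [add_comm]
    · exact (add_pos_of_nonneg_of_pos zero_le (inv_pos.2 (pos_iff_ne_zero.2 ha))).ne'

theorem seriesCond_le (x : ℝ≥0) (a : ℝ≥0∞) : seriesCond x a ≤ a := by
  rw [seriesCond, ENNReal.inv_le_iff_inv_le]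
  exact le_add_self

theorem seriesCond_le_inv (x : ℝ≥0) (a : ℝ≥0∞) : seriesCond x a ≤ (x : ℝ≥0∞)⁻¹ :=
  ENNReal.inv_le_inv.2 le_self_add

theorem seriesCond_mono (x : ℝ≥0) : Monotone (seriesCond x) := fun _ _ h =>
  ENNReal.inv_le_inv.2 (by gcongr)

theorem seriesCond_eq_zero {x : ℝ≥0} {a : ℝ≥0∞} : seriesCond x a = 0 ↔ a = 0 := by
  simp [seriesCond]

/-- **Thomson's principle** for two resistances in series, with a trial flow that is optimal when
the conductance `a` is equal to `c`. -/
theorem seriesCond_le_trial (x c : ℝ≥0) (a : ℝ≥0∞) :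
    seriesCond x a ≤ (a + x * c ^ 2) * (((1 + x * c) ^ 2 : ℝ≥0) : ℝ≥0∞)⁻¹ := by
  induction a with
  | top =>
    rw [top_add, ENNReal.top_mul (ENNReal.inv_ne_zero.2 ENNReal.coe_ne_top)]
    exact le_top
  | coe a =>
    rw [seriesCond_coe, ← ENNReal.coe_inv (by positivity)]
    norm_cast
    rw [← div_eq_mul_inv, div_le_div_iff₀ (by positivity) (by positivity), ← NNReal.coe_le_coe]
    push_cast
    -- After clearing denominators the two sides differ by exactly `x (c - a)²`.
    nlinarith [mul_nonneg x.2 (sq_nonneg ((c : ℝ) - a))]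

/-- This factorization of `a²` is what lets Cauchy–Schwarz bound the mean of the series conductance
from below. -/
theorem mul_self_eq_seriesCond_mul (x : ℝ≥0) {a : ℝ≥0∞} (ha : a ≠ ⊤) :
    a * a = seriesCond x a * (a + x * a ^ 2) := by
  lift a to ℝ≥0 using ha
  rw [seriesCond_coe]
  norm_cast
  field_simp

/-- The quotient `seriesCond x a / a = 1 / (1 + x a)` decreases in `a`, so it is ordered oppositely
to `a`; this is the two-point Chebyshev inequality multiplied by `a b`. -/
theorem seriesCond_chebyshev (x : ℝ≥0) {a b : ℝ≥0∞} (ha : a ≠ ⊤) (hb : b ≠ ⊤) :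
    a * seriesCond x a * b + b * seriesCond x b * a ≤
      a ^ 2 * seriesCond x b + b ^ 2 * seriesCond x a := by
  lift a to ℝ≥0 using ha
  lift b to ℝ≥0 using hb
  simp_rw [seriesCond_coe]
  norm_cast
  rw [← NNReal.coe_le_coe]
  push_cast
  have key : (a : ℝ) ^ 2 * (b / (1 + x * b)) + b ^ 2 * (a / (1 + x * a)) -
      (a * (a / (1 + x * a)) * b + b * (b / (1 + x * b)) * a) =
      a * b * x * (a - b) ^ 2 / ((1 + x * a) * (1 + x * b)) := by
    field_simp
    ring
  have : 0 ≤ (a : ℝ) * b * x * (a - b) ^ 2 / ((1 + x * a) * (1 + x * b)) := by positivity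
  linarith

theorem MeasureTheory.lintegral_lintegral_mul_add_mul {α : Type*} [MeasurableSpace α]
    {Q : Measure α} [SFinite Q] {f g h k : α → ℝ≥0∞} (hf : Measurable f) (hg : Measurable g)
    (hh : Measurable h) (hk : Measurable k) :
    ∫⁻ x, ∫⁻ y, (f x * g y + h x * k y) ∂Q ∂Q =
      (∫⁻ x, f x ∂Q) * (∫⁻ x, g x ∂Q) + (∫⁻ x, h x ∂Q) * ∫⁻ x, k x ∂Q := by
  rw [← lintegral_lintegral_mul hf.aemeasurable hg.aemeasurable,
    ← lintegral_lintegral_mul hh.aemeasurable hk.aemeasurable, ← lintegral_add_left]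
  · exact lintegral_congr fun x => lintegral_add_left (by fun_prop) _
  · exact Measurable.lintegral_prod_right' (f := fun z : α × α => f z.1 * g z.2) (by fun_prop)

/-! ### Recursive inequalities for the moments of the conductance. -/

namespace MarkedTree

theorem inSeries_apply (f : MarkedTree → ℝ≥0∞) (τ : MarkedTree) :
    inSeries f τ = seriesCond (τ.2 []) (f τ) := rfl

theorem inSeries_le (f : MarkedTree → ℝ≥0∞) : inSeries f ≤ f := fun _ => seriesCond_le _ _

theorem inSeries_mono {f h : MarkedTree → ℝ≥0∞} (hfh : f ≤ h) : inSeries f ≤ inSeries h :=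
  fun τ => seriesCond_mono _ (hfh τ)

theorem childMean_mono (m : ℝ≥0) : Monotone (childMean m) := fun f h hfh τ => by
  unfold childMean
  gcongr
  exact hfh _

/-- Iterating a monotone operator from the top element gives a decreasing sequence. -/
theorem cond_antitone (m : ℝ≥0) : Antitone (cond m) := by
  refine antitone_nat_of_succ_le fun n => ?_
  induction n with
  | zero => exact fun _ => le_top
  | succ n ih => exact childMean_mono m (inSeries_mono ih)

/-- Setting the resistances of the first `k` levels to zero can only raise the conductance. -/
theorem cond_add_le (m : ℝ≥0) (n k : ℕ) : cond m (n + k) ≤ (childMean m)^[k] (cond m n) := by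
  induction k with
  | zero => exact le_rfl
  | succ k ih =>
    rw [Function.iterate_succ_apply', ← add_assoc, cond_succ]
    exact childMean_mono m ((inSeries_le _).trans ih)

theorem RootFree.comp {α β : Type*} {f : MarkedTree → α} (hf : RootFree f) (φ : α → β) :
    RootFree fun τ => φ (f τ) :=
  fun N ξ ξ' h => congrArg φ (hf N ξ ξ' h)

section Moments

variable {ρ : Measure ℕ} {μ : Measure ℝ≥0} [IsProbabilityMeasure ρ] [IsProbabilityMeasure μ]
  {m : ℝ≥0}

theorem lintegral_inSeries {f : MarkedTree → ℝ≥0∞} (hf : Measurable f) (hfree : RootFree f) :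
    ∫⁻ τ, inSeries f τ ∂law ρ μ = ∫⁻ x, ∫⁻ τ, seriesCond x (f τ) ∂law ρ μ ∂μ :=
  lintegral_rootMark ρ μ (f := fun x τ => seriesCond x (f τ)) (by unfold seriesCond; fun_prop)
    fun x => hfree.comp (seriesCond x)

theorem lintegral_mark_mul {f : MarkedTree → ℝ≥0∞} (hf : Measurable f) (hfree : RootFree f)
    {g : ℝ≥0 → ℝ≥0∞} (hg : Measurable g) :
    ∫⁻ τ, g (τ.2 []) * f τ ∂law ρ μ = (∫⁻ x, g x ∂μ) * ∫⁻ τ, f τ ∂law ρ μ := by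
  rw [lintegral_rootMark ρ μ (f := fun x τ => g x * f τ) (by fun_prop)
    fun x => hfree.comp (g x * ·)]
  simp_rw [lintegral_const_mul _ hf]
  rw [lintegral_mul_const _ hg]

theorem lintegral_cond_succ (hm0 : m ≠ 0) (hm : ∫⁻ n : ℕ, (n : ℝ≥0∞) ∂ρ = m) (n : ℕ) :
    ∫⁻ τ, cond m (n + 1) τ ∂law ρ μ = ∫⁻ τ, inSeries (cond m n) τ ∂law ρ μ :=
  lintegral_childMean hm0 hm (measurable_inSeries (measurable_cond m n))

theorem lintegral_cond_ne_zero (hm0 : m ≠ 0) (hm : ∫⁻ n : ℕ, (n : ℝ≥0∞) ∂ρ = m) (n : ℕ) :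
    ∫⁻ τ, cond m n τ ∂law ρ μ ≠ 0 := by
  induction n with
  | zero => simp [cond]
  | succ n ih =>
    rw [lintegral_cond_succ hm0 hm]
    contrapose! ih
    rw [lintegral_eq_zero_iff (by fun_prop)] at ih ⊢
    filter_upwards [ih] with τ hτ
    exact seriesCond_eq_zero.1 hτ

theorem lintegral_cond_succ_le (hm0 : m ≠ 0) (hm : ∫⁻ n : ℕ, (n : ℝ≥0∞) ∂ρ = m) (n : ℕ) :
    ∫⁻ τ, cond m (n + 1) τ ∂law ρ μ ≤ ∫⁻ x : ℝ≥0, (x : ℝ≥0∞)⁻¹ ∂μ := by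
  rw [lintegral_cond_succ hm0 hm]
  calc _ ≤ ∫⁻ τ, (fun x : ℝ≥0 => (x : ℝ≥0∞)⁻¹) (τ.2 []) * 1 ∂law ρ μ :=
        lintegral_mono fun τ => (seriesCond_le_inv _ _).trans_eq (mul_one _).symm
    _ = _ := by
        refine (lintegral_mark_mul (f := fun _ => 1) measurable_const (fun _ _ _ _ => rfl)
          (g := fun x : ℝ≥0 => (x : ℝ≥0∞)⁻¹) (by fun_prop)).trans ?_
        simp

theorem lintegral_sq_cond_succ (hm0 : m ≠ 0) (hm : ∫⁻ n : ℕ, (n : ℝ≥0∞) ∂ρ = m) (n : ℕ) :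
    ∫⁻ τ, cond m (n + 1) τ ^ 2 ∂law ρ μ =
      (m : ℝ≥0∞)⁻¹ * ∫⁻ τ, inSeries (cond m n) τ ^ 2 ∂law ρ μ +
        pairFactor m ρ * (∫⁻ τ, cond m (n + 1) τ ∂law ρ μ) ^ 2 := by
  rw [lintegral_cond_succ hm0 hm]
  simp_rw [sq]
  exact lintegral_childMean_mul_childMean hm0 hm (measurable_inSeries (measurable_cond m n))
    (measurable_inSeries (measurable_cond m n))

/-- At level `1` the second moment may be infinite, since `ξ⁻²` need not be integrable. From level
`2` on, one factor of the squared series conductance is bounded by `ξ⁻¹` and the other by a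
conductance independent of `ξ`, so first moments suffice. -/
theorem lintegral_sq_cond_lt_top (hm0 : m ≠ 0) (hm : ∫⁻ n : ℕ, (n : ℝ≥0∞) ∂ρ = m)
    (h2 : ∫⁻ n : ℕ, (n : ℝ≥0∞) ^ 2 ∂ρ < ⊤) (hinv : ∫⁻ x : ℝ≥0, (x : ℝ≥0∞)⁻¹ ∂μ < ⊤) (n : ℕ) :
    ∫⁻ τ, cond m (n + 2) τ ^ 2 ∂law ρ μ < ⊤ := by
  have hc := fun n => (lintegral_cond_succ_le (ρ := ρ) (μ := μ) hm0 hm n).trans_lt hinv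
  rw [lintegral_sq_cond_succ hm0 hm]
  refine ENNReal.add_lt_top.2 ⟨ENNReal.mul_lt_top (by simpa [pos_iff_ne_zero] using hm0) ?_,
    ENNReal.mul_lt_top (pairFactor_lt_top hm0 h2) (ENNReal.pow_lt_top (hc _))⟩
  calc ∫⁻ τ, inSeries (cond m (n + 1)) τ ^ 2 ∂law ρ μ
      ≤ ∫⁻ τ, (fun x : ℝ≥0 => (x : ℝ≥0∞)⁻¹) (τ.2 []) * cond m (n + 1) τ ∂law ρ μ := by
        refine lintegral_mono fun τ => ?_
        rw [sq]
        exact mul_le_mul' (seriesCond_le_inv _ _) (seriesCond_le _ _)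
    _ = _ := lintegral_mark_mul (measurable_cond m (n + 1)) (rootFree_cond m _)
        (g := fun x : ℝ≥0 => (x : ℝ≥0∞)⁻¹) (by fun_prop)
    _ < ⊤ := ENNReal.mul_lt_top hinv (hc n)

/-- A lower bound for the decay of the mean conductance. -/
theorem sq_lintegral_cond_le (hm0 : m ≠ 0) (hm : ∫⁻ n : ℕ, (n : ℝ≥0∞) ∂ρ = m)
    {n : ℕ} (hn : ∫⁻ τ, cond m n τ ∂law ρ μ ≠ ⊤) :
    (∫⁻ τ, cond m n τ ∂law ρ μ) ^ 2 ≤ (∫⁻ τ, cond m (n + 1) τ ∂law ρ μ) *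
      (∫⁻ τ, cond m n τ ∂law ρ μ + (∫⁻ x : ℝ≥0, (x : ℝ≥0∞) ∂μ) *
        ∫⁻ τ, cond m n τ ^ 2 ∂law ρ μ) := by
  have hfin : ∀ᵐ τ ∂law ρ μ, cond m n τ ≠ ⊤ := by
    filter_upwards [ae_lt_top (by fun_prop) hn] with τ hτ using hτ.ne
  have hsum : ∫⁻ τ, (cond m n τ + τ.2 [] * cond m n τ ^ 2) ∂law ρ μ =
      ∫⁻ τ, cond m n τ ∂law ρ μ + (∫⁻ x : ℝ≥0, (x : ℝ≥0∞) ∂μ) *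
        ∫⁻ τ, cond m n τ ^ 2 ∂law ρ μ := by
    rw [lintegral_add_left (by fun_prop)]
    congr 1
    exact lintegral_mark_mul (f := fun τ => cond m n τ ^ 2) (g := fun x => (x : ℝ≥0∞))
      (by fun_prop) ((rootFree_cond m n).comp (· ^ 2)) (by fun_prop)
  rw [← hsum, lintegral_cond_succ hm0 hm]
  set A := ∫⁻ τ, inSeries (cond m n) τ ∂law ρ μ
  set B := ∫⁻ τ, (cond m n τ + τ.2 [] * cond m n τ ^ 2) ∂law ρ μ
  -- Cauchy–Schwarz for the square roots of the two factors in `mul_self_eq_seriesCond_mul`, whose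
  -- product is `cond m n` itself.
  have hcs := ENNReal.lintegral_mul_le_Lp_mul_Lq (law ρ μ) Real.HolderConjugate.two_two
    (f := fun τ => inSeries (cond m n) τ ^ (1 / 2 : ℝ))
    (g := fun τ => (cond m n τ + τ.2 [] * cond m n τ ^ 2) ^ (1 / 2 : ℝ))
    (by fun_prop) (by fun_prop)
  have hpt : ∀ᵐ τ ∂law ρ μ, cond m n τ = ((fun τ => inSeries (cond m n) τ ^ (1 / 2 : ℝ)) *
      fun τ => (cond m n τ + τ.2 [] * cond m n τ ^ 2) ^ (1 / 2 : ℝ)) τ := by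
    filter_upwards [hfin] with τ hτ
    rw [Pi.mul_apply, ← ENNReal.mul_rpow_of_nonneg _ _ (by norm_num), inSeries_apply,
      ← mul_self_eq_seriesCond_mul _ hτ, ← sq, ← ENNReal.rpow_natCast, ← ENNReal.rpow_mul]
    norm_num
  rw [← lintegral_congr_ae hpt] at hcs
  simp only [← ENNReal.rpow_mul] at hcs
  norm_num at hcs
  calc (∫⁻ τ, cond m n τ ∂law ρ μ) ^ 2
      ≤ (A ^ (1 / 2 : ℝ) * B ^ (1 / 2 : ℝ)) ^ 2 := by gcongr
    _ = A * B := by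
      rw [mul_pow, ← ENNReal.rpow_natCast, ← ENNReal.rpow_natCast, ← ENNReal.rpow_mul,
        ← ENNReal.rpow_mul]
      norm_num

/-- An upper bound for the decay of the mean conductance. -/
theorem lintegral_cond_succ_add_le (hm0 : m ≠ 0) (hm : ∫⁻ n : ℕ, (n : ℝ≥0∞) ∂ρ = m)
    {n : ℕ} {b : ℝ≥0} (hb : ∫⁻ τ, cond m n τ ∂law ρ μ ≤ b) :
    ∫⁻ τ, cond m (n + 1) τ ∂law ρ μ +
      (∫⁻ x : ℝ≥0, ((x / (1 + x * b) : ℝ≥0) : ℝ≥0∞) ∂μ) * (∫⁻ τ, cond m n τ ∂law ρ μ) ^ 2 ≤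
      ∫⁻ τ, cond m n τ ∂law ρ μ := by
  obtain ⟨c, hc⟩ : ∃ c : ℝ≥0, (c : ℝ≥0∞) = ∫⁻ τ, cond m n τ ∂law ρ μ :=
    ⟨_, ENNReal.coe_toNNReal (ne_top_of_le_ne_top ENNReal.coe_ne_top hb)⟩
  rw [← hc] at hb ⊢
  have hcb : c ≤ b := by exact_mod_cast hb
  rw [lintegral_cond_succ hm0 hm, lintegral_inSeries (by fun_prop) (rootFree_cond m n),
    ← lintegral_mul_const _ (by fun_prop), ← lintegral_add_right _ (by fun_prop)]
  calc _ ≤ ∫⁻ _ : ℝ≥0, (c : ℝ≥0∞) ∂μ := by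
        refine lintegral_mono fun x => ?_
        -- The trial flow is tuned to the mean `c`. Its bound is affine in the conductance, so after
        -- integration only `c` remains.
        have h1 : ∫⁻ τ, seriesCond x (cond m n τ) ∂law ρ μ ≤
            (c + x * c ^ 2) * (((1 + x * c) ^ 2 : ℝ≥0) : ℝ≥0∞)⁻¹ := by
          refine (lintegral_mono fun τ => seriesCond_le_trial x c _).trans ?_
          rw [lintegral_mul_const _ (by fun_prop), lintegral_add_right _ (by fun_prop), ← hc,
            lintegral_const, measure_univ, mul_one]
        refine (add_le_add_left h1 _).trans ?_
        rw [← ENNReal.coe_inv (by positivity)]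
        norm_cast
        rw [← NNReal.coe_le_coe]
        push_cast
        have h2 : ((c : ℝ) + x * c ^ 2) * ((1 + (x : ℝ) * c) ^ 2)⁻¹ = c - c ^ 2 * (x / (1 + x * c)) := by
          field_simp
          ring
        -- Replacing `c` by its bound `b` makes the coefficient of the quadratic term independent of
        -- `n`.
        have h3 : (x : ℝ) / (1 + x * b) ≤ x / (1 + x * c) := by gcongr
        rw [h2]
        nlinarith [mul_le_mul_of_nonneg_left h3 (sq_nonneg (c : ℝ))]
    _ = c := by simp

/-- Adding a resistance in series decreases the size-biased mean. -/
theorem lintegral_cond_mul_inSeries_le (hm0 : m ≠ 0) (hm : ∫⁻ n : ℕ, (n : ℝ≥0∞) ∂ρ = m)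
    {n : ℕ} (hn : ∫⁻ τ, cond m n τ ∂law ρ μ ≠ ⊤) :
    (∫⁻ τ, cond m n τ * inSeries (cond m n) τ ∂law ρ μ) * ∫⁻ τ, cond m n τ ∂law ρ μ ≤
      (∫⁻ τ, cond m n τ ^ 2 ∂law ρ μ) * ∫⁻ τ, cond m (n + 1) τ ∂law ρ μ := by
  have hfin : ∀ᵐ τ ∂law ρ μ, cond m n τ ≠ ⊤ := by
    filter_upwards [ae_lt_top (by fun_prop) hn] with τ hτ using hτ.ne
  have hmeas : Measurable (cond m n) := by fun_prop
  have hs : ∀ x, Measurable fun τ => seriesCond x (cond m n τ) := fun x => by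
    unfold seriesCond; fun_prop
  have hfree : ∫⁻ τ, cond m n τ * inSeries (cond m n) τ ∂law ρ μ =
      ∫⁻ x, ∫⁻ τ, cond m n τ * seriesCond x (cond m n τ) ∂law ρ μ ∂μ :=
    lintegral_rootMark ρ μ (f := fun x τ => cond m n τ * seriesCond x (cond m n τ))
      (by unfold seriesCond; fun_prop) fun x =>
        (rootFree_cond m n).comp fun a => a * seriesCond x a
  have hx1 : Measurable fun x => ∫⁻ τ, cond m n τ * seriesCond x (cond m n τ) ∂law ρ μ :=
    Measurable.lintegral_prod_right' (f := fun z : ℝ≥0 × MarkedTree =>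
      cond m n z.2 * seriesCond z.1 (cond m n z.2)) (by unfold seriesCond; fun_prop)
  have hx2 : Measurable fun x => ∫⁻ τ, seriesCond x (cond m n τ) ∂law ρ μ :=
    Measurable.lintegral_prod_right' (f := fun z : ℝ≥0 × MarkedTree =>
      seriesCond z.1 (cond m n z.2)) (by unfold seriesCond; fun_prop)
  rw [hfree, lintegral_cond_succ hm0 hm, lintegral_inSeries (by fun_prop) (rootFree_cond m n),
    ← lintegral_mul_const _ hx1, ← lintegral_const_mul _ hx2]
  refine lintegral_mono fun x => ?_
  -- The two-point inequality is integrated over two independent copies of the tree; by symmetry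
  -- each side is twice the desired one.
  have key : ∫⁻ τ, ∫⁻ τ', (cond m n τ * seriesCond x (cond m n τ) * cond m n τ' +
        cond m n τ * (cond m n τ' * seriesCond x (cond m n τ'))) ∂law ρ μ ∂law ρ μ ≤
      ∫⁻ τ, ∫⁻ τ', (cond m n τ ^ 2 * seriesCond x (cond m n τ') +
        seriesCond x (cond m n τ) * cond m n τ' ^ 2) ∂law ρ μ ∂law ρ μ := by
    refine lintegral_mono_ae ?_
    filter_upwards [hfin] with τ hτ
    refine lintegral_mono_ae ?_
    filter_upwards [hfin] with τ' hτ'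
    rw [mul_comm (cond m n τ) (cond m n τ' * _), mul_comm _ (cond m n τ' ^ 2)]
    exact seriesCond_chebyshev x hτ hτ'
  have hS := hs x
  have hCS : Measurable fun τ => cond m n τ * seriesCond x (cond m n τ) := hmeas.mul hS
  rw [lintegral_lintegral_mul_add_mul hCS hmeas hmeas hCS,
    lintegral_lintegral_mul_add_mul (hmeas.pow_const 2) hS hS (hmeas.pow_const 2),
    mul_comm (∫⁻ τ, cond m n τ ∂law ρ μ), mul_comm (∫⁻ τ, seriesCond x (cond m n τ) ∂law ρ μ),
    ← two_mul, ← two_mul] at key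
  exact (ENNReal.mul_le_mul_iff_right (by simp) (by simp)).1 key

/-- Relaxing only one of the two factors `inSeries` keeps a mixed moment to which Chebyshev's
inequality applies. The gain over relaxing both is the ratio of consecutive means. -/
theorem lintegral_sq_cond_succ_mul_le (hm0 : m ≠ 0) (hm : ∫⁻ n : ℕ, (n : ℝ≥0∞) ∂ρ = m)
    {n : ℕ} (hn : ∫⁻ τ, cond m n τ ∂law ρ μ ≠ ⊤) :
    (∫⁻ τ, cond m (n + 1) τ ^ 2 ∂law ρ μ) * ∫⁻ τ, cond m n τ ∂law ρ μ ≤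
      (m : ℝ≥0∞)⁻¹ * ((∫⁻ τ, cond m n τ ^ 2 ∂law ρ μ) * ∫⁻ τ, cond m (n + 1) τ ∂law ρ μ) +
      pairFactor m ρ * (∫⁻ τ, cond m (n + 1) τ ∂law ρ μ) ^ 2 *
        ∫⁻ τ, cond m n τ ∂law ρ μ := by
  rw [lintegral_sq_cond_succ hm0 hm, add_mul, mul_assoc]
  have h : ∫⁻ τ, inSeries (cond m n) τ ^ 2 ∂law ρ μ ≤
      ∫⁻ τ, cond m n τ * inSeries (cond m n) τ ∂law ρ μ := by
    refine lintegral_mono fun τ => ?_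
    rw [sq]
    exact mul_le_mul' (inSeries_le _ _) le_rfl
  exact add_le_add_left (mul_le_mul_right
    ((mul_le_mul_left h _).trans (lintegral_cond_mul_inSeries_le hm0 hm hn)) _) _

end Moments

end MarkedTree

/-! ### Real sequences -/

theorem exists_forall_le_of_eventually_le_mul_add {x : ℕ → ℝ} {r b : ℝ} (hr0 : 0 ≤ r) (hr : r < 1)
    (h : ∀ᶠ n in atTop, x (n + 1) ≤ r * x n + b) : ∃ K, ∀ n, x n ≤ K := by
  obtain ⟨n₀, hn₀⟩ := eventually_atTop.1 h
  -- The value `b / (1 - r)` is the fixed point of `t ↦ r t + b`, so any bound at least this large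
  -- propagates.
  have hK : ∀ n ≥ n₀, x n ≤ max (x n₀) (b / (1 - r)) := by
    intro n hn
    induction n, hn using Nat.le_induction with
    | base => exact le_max_left _ _
    | succ n hn ih =>
      refine (hn₀ n hn).trans ?_
      have hb : b ≤ max (x n₀) (b / (1 - r)) * (1 - r) :=
        (div_le_iff₀ (by linarith)).1 (le_max_right _ _)
      nlinarith [mul_le_mul_of_nonneg_left ih hr0]
  have hbdd : IsBoundedUnder (· ≤ ·) atTop x :=
    isBoundedUnder_of_eventually_le (eventually_atTop.2 ⟨n₀, hK⟩)
  obtain ⟨K, hK⟩ := hbdd.bddAbove_range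
  exact ⟨K, fun n => hK ⟨n, rfl⟩⟩

theorem tendsto_zero_of_le_mul_add {x b : ℕ → ℝ} {r : ℝ} (hx : ∀ n, 0 ≤ x n) (hr0 : 0 ≤ r)
    (hr : r < 1) (h : ∀ n, x (n + 1) ≤ r * x n + b n) (hb : Tendsto b atTop (𝓝 0)) :
    Tendsto x atTop (𝓝 0) := by
  rw [Metric.tendsto_atTop]
  intro ε hε
  have hε' : 0 < ε / 2 * (1 - r) := mul_pos (half_pos hε) (by linarith)
  obtain ⟨n₀, hn₀⟩ := eventually_atTop.1 (hb.eventually_lt_const hε')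
  have key : ∀ k, x (n₀ + k) ≤ r ^ k * x n₀ + ε / 2 := by
    intro k
    induction k with
    | zero => simpa using (half_pos hε).le
    | succ k ih =>
      have h1 := h (n₀ + k)
      have h2 := hn₀ (n₀ + k) (by lia)
      rw [← add_assoc, pow_succ]
      nlinarith [mul_le_mul_of_nonneg_left ih hr0]
  have hpow : Tendsto (fun k => r ^ k * x n₀) atTop (𝓝 0) := by
    simpa using (tendsto_pow_atTop_nhds_zero_of_lt_one hr0 hr).mul_const (x n₀)
  obtain ⟨k₀, hk₀⟩ := eventually_atTop.1 (hpow.eventually_lt_const (half_pos hε))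
  refine ⟨n₀ + k₀, fun n hn => ?_⟩
  obtain ⟨k, rfl⟩ := Nat.exists_eq_add_of_le hn
  rw [Real.dist_0_eq_abs, abs_of_nonneg (hx _), add_assoc]
  linarith [key (k₀ + k), hk₀ (k₀ + k) (by lia)]

/-- If `c` and `s` satisfy the recursive inequalities of the first and second moments of the
conductance, then `c n` is of order `1 / n` and `s n` is of order `c n ^ 2`. -/
theorem exists_decay_bounds {c s : ℕ → ℝ} {δ E m κ : ℝ} (hc : ∀ n, 0 < c n) (hs : ∀ n, 0 ≤ s n)
    (hδ : 0 < δ) (hE : 0 ≤ E) (hm : 1 < m)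
    (h1 : ∀ n, c (n + 1) + δ * c n ^ 2 ≤ c n)
    (h2 : ∀ n, c n ^ 2 ≤ c (n + 1) * (c n + E * s n))
    (h3 : ∀ n, s (n + 1) * c n ≤ m⁻¹ * (s n * c (n + 1)) + κ * c (n + 1) ^ 2 * c n) :
    ∃ K > 0, ∀ n : ℕ, c n * (n + 1) ≤ K ∧ s n ≤ K * c n ^ 2 ∧ c n ≤ c (n + 1) * (1 + K * c n) := by
  have hm0 : 0 < m := by linarith
  -- By `h1` each step raises the reciprocal of `c` by at least `δ`.
  have hinv : ∀ n : ℕ, (c 0)⁻¹ + δ * n ≤ (c n)⁻¹ := by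
    intro n
    induction n with
    | zero => simp
    | succ n ih =>
      have hstep : (c n)⁻¹ + δ ≤ (c (n + 1))⁻¹ := by
        have hcn := hc n
        rw [← one_div (c (n + 1)), le_div_iff₀ (hc (n + 1))]
        have h4 : ((c n)⁻¹ + δ) * c (n + 1) ≤ ((c n)⁻¹ + δ) * (c n - δ * c n ^ 2) := by
          have := h1 n
          gcongr
          linarith
        have h5 : ((c n)⁻¹ + δ) * (c n - δ * c n ^ 2) = 1 - δ ^ 2 * c n ^ 2 := by
          field_simp
          ring
        nlinarith [sq_nonneg (δ * c n)]
      push_cast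
      linarith
  -- Chosen so that `η (n + 1) ≤ (c 0)⁻¹ + δ n`.
  set η := min (c 0)⁻¹ δ with hη
  have hη0 : 0 < η := lt_min (inv_pos.2 (hc 0)) hδ
  have hdecay : ∀ n : ℕ, c n * (n + 1) ≤ η⁻¹ := by
    intro n
    have h4 : η * (n + 1) ≤ (c n)⁻¹ := by
      have h5 := hinv n
      have h6 : η * n ≤ δ * n := by gcongr; exact min_le_right _ _
      have h7 : η ≤ (c 0)⁻¹ := min_le_left _ _
      linarith
    have hcn := hc n
    rw [← one_div η, le_div_iff₀ hη0]
    calc c n * (n + 1) * η = c n * (η * (n + 1)) := by ring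
      _ ≤ c n * (c n)⁻¹ := by gcongr
      _ = 1 := mul_inv_cancel₀ hcn.ne'
  have hc0 : Tendsto c atTop (𝓝 0) := by
    have h4 : Tendsto (fun n : ℕ => η⁻¹ * (1 / ((n : ℝ) + 1))) atTop (𝓝 0) := by
      simpa using tendsto_one_div_add_atTop_nhds_zero_nat.const_mul η⁻¹
    refine squeeze_zero (fun n => (hc n).le) (fun n => ?_) h4
    rw [mul_one_div, le_div_iff₀ (by positivity)]
    exact hdecay n
  -- Divided by `c n * c (n + 1)`, `h3` is a contraction by `m⁻¹` with an error tending to `0`.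
  have ht : Tendsto (fun n => s n / c n) atTop (𝓝 0) := by
    refine tendsto_zero_of_le_mul_add (r := m⁻¹) (b := fun n => κ * c (n + 1))
      (fun n => div_nonneg (hs n) (hc n).le) (inv_nonneg.2 hm0.le) (inv_lt_one_of_one_lt₀ hm)
      (fun n => ?_) ?_
    · have hcn := hc n
      have hcn1 := hc (n + 1)
      rw [div_le_iff₀ hcn1]
      refine le_of_mul_le_mul_right ((h3 n).trans_eq ?_) hcn
      field_simp
    · simpa using ((tendsto_add_atTop_iff_nat 1).2 hc0).const_mul κ
  -- For `s / c²` the factor is `m⁻¹ c n / c (n + 1)`. By `h2` the ratio of means is at most `1 + E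
  -- s n / c n`, which tends to `1`, so the factor eventually falls below the midpoint of `m⁻¹` and
  -- `1`.
  obtain ⟨q, hq⟩ : ∃ q, ∀ n, s n / c n ^ 2 ≤ q := by
    have hr1 : (1 + m⁻¹) / 2 < 1 := by linarith [inv_lt_one_of_one_lt₀ hm]
    have hev : ∀ᶠ n in atTop, m⁻¹ * (1 + E * (s n / c n)) < (1 + m⁻¹) / 2 := by
      have : Tendsto (fun n => m⁻¹ * (1 + E * (s n / c n))) atTop (𝓝 (m⁻¹ * (1 + E * 0))) :=
        ((ht.const_mul E).const_add 1).const_mul _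
      refine this.eventually_lt_const ?_
      linarith [inv_lt_one_of_one_lt₀ hm]
    refine exists_forall_le_of_eventually_le_mul_add (r := (1 + m⁻¹) / 2) (b := κ)
      (by positivity) hr1 ?_
    filter_upwards [hev] with n hn
    have hcn := hc n
    have hcn1 := hc (n + 1)
    have hq0 : 0 ≤ s n / c n ^ 2 := div_nonneg (hs n) (sq_nonneg _)
    refine le_trans ?_ (add_le_add_left (mul_le_mul_of_nonneg_right hn.le hq0) κ)
    have hratio : c n / c (n + 1) ≤ 1 + E * (s n / c n) := by
      rw [div_le_iff₀ hcn1]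
      refine le_of_mul_le_mul_right ?_ hcn
      calc c n * c n = c n ^ 2 := by ring
        _ ≤ _ := h2 n
        _ = _ := by field_simp
    calc s (n + 1) / c (n + 1) ^ 2 ≤ m⁻¹ * (c n / c (n + 1)) * (s n / c n ^ 2) + κ := by
          rw [div_le_iff₀ (by positivity)]
          refine le_of_mul_le_mul_right ((h3 n).trans_eq ?_) hcn
          field_simp
      _ ≤ _ := by gcongr
  set K := max η⁻¹ (max (max q 0) (E * max q 0)) with hK
  have hK1 : η⁻¹ ≤ K := le_max_left _ _
  have hK2 : max q 0 ≤ K := (le_max_left _ _).trans (le_max_right _ _)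
  have hK3 : E * max q 0 ≤ K := (le_max_right _ _).trans (le_max_right _ _)
  have hs' : ∀ n, s n ≤ max q 0 * c n ^ 2 := fun n =>
    (div_le_iff₀ (pow_pos (hc n) 2)).1 ((hq n).trans (le_max_left _ _))
  refine ⟨K, (inv_pos.2 hη0).trans_le hK1, fun n => ⟨(hdecay n).trans hK1, (hs' n).trans ?_, ?_⟩⟩
  · gcongr
  · have hcn := hc n
    have hcn1 := hc (n + 1)
    refine le_of_mul_le_mul_right ?_ hcn
    calc c n * c n = c n ^ 2 := by ring
      _ ≤ c (n + 1) * (c n + E * s n) := h2 n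
      _ ≤ c (n + 1) * (c n + E * (max q 0 * c n ^ 2)) := by gcongr; exact hs' n
      _ = c (n + 1) * (1 + E * max q 0 * c n) * c n := by ring
      _ ≤ _ := by gcongr

/-- The hypothesis says that the reciprocal grows by at most `K` per step; this telescopes. -/
theorem div_le_one_add_mul_of_le {K : ℝ} {c : ℕ → ℝ} (hK : 0 ≤ K) (hc : ∀ n, 0 < c n)
    (h : ∀ n, c n ≤ c (n + 1) * (1 + K * c n)) (n k : ℕ) :
    c n / c (n + k) ≤ 1 + K * k * c n := by
  have key : (c (n + k))⁻¹ ≤ (c n)⁻¹ + K * k := by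
    induction k with
    | zero => simp
    | succ k ih =>
      have h1 := hc (n + k)
      have h2 := hc (n + k + 1)
      have h3 : (c (n + k + 1))⁻¹ ≤ (c (n + k))⁻¹ + K := by
        rw [inv_le_iff_one_le_mul₀ h2]
        refine le_of_mul_le_mul_left ?_ h1
        calc c (n + k) * 1 ≤ c (n + k + 1) * (1 + K * c (n + k)) := by simpa using h (n + k)
          _ = _ := by field_simp
      rw [← add_assoc]
      push_cast
      linarith
  have hn := hc n
  rw [div_eq_mul_inv]
  calc c n * (c (n + k))⁻¹ ≤ c n * ((c n)⁻¹ + K * k) := by gcongr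
    _ = _ := by field_simp

/-- If two antitone sequences have a convergent ratio along a slowly growing subsequence of the
indices, then their ratio converges. -/
theorem tendsto_div_of_antitone_of_subseq {a c : ℕ → ℝ} {N : ℕ → ℕ} {w : ℝ}
    (ha : Antitone a) (hc : Antitone c) (ha0 : ∀ n, 0 ≤ a n) (hc0 : ∀ n, 0 < c n)
    (hN : StrictMono N) (hN0 : N 0 = 0)
    (hw : Tendsto (fun j => a (N j) / c (N j)) atTop (𝓝 w))
    (hr : Tendsto (fun j => c (N j) / c (N (j + 1))) atTop (𝓝 1)) :
    Tendsto (fun n => a n / c n) atTop (𝓝 w) := by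
  -- `J n` is the block with `N (J n) ≤ n ≤ N (J n + 1)`. Searching up to `n` is enough because `j ≤
  -- N j`.
  set J : ℕ → ℕ := fun n => Nat.findGreatest (fun j => N j ≤ n) n with hJ
  have hJ1 : ∀ n, N (J n) ≤ n := fun n =>
    Nat.findGreatest_spec (P := fun j => N j ≤ n) (Nat.zero_le n) (by simp [hN0])
  have hJ2 : ∀ n, n ≤ N (J n + 1) := by
    intro n
    by_contra! h
    exact Nat.findGreatest_is_greatest (P := fun j => N j ≤ n) (Nat.lt_succ_self (J n))
      ((hN.id_le _).trans h.le) h.le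
  have hJtop : Tendsto J atTop atTop := by
    refine tendsto_atTop.2 fun j => ?_
    filter_upwards [eventually_ge_atTop (N j)] with n hn
    exact Nat.le_findGreatest ((hN.id_le j).trans hn) hn
  have hlow : Tendsto (fun j => a (N (j + 1)) / c (N (j + 1)) * (c (N j) / c (N (j + 1)))⁻¹) atTop
      (𝓝 w) := by
    simpa using ((tendsto_add_atTop_iff_nat 1).2 hw).mul (hr.inv₀ one_ne_zero)
  have hupp : Tendsto (fun j => a (N j) / c (N j) * (c (N j) / c (N (j + 1)))) atTop (𝓝 w) := by
    simpa using hw.mul hr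
  refine tendsto_of_tendsto_of_tendsto_of_le_of_le (hlow.comp hJtop) (hupp.comp hJtop)
    (fun n => ?_) (fun n => ?_)
  all_goals
    have h1 := hc0 (N (J n))
    have h3 := hc0 (N (J n + 1))
    rw [Function.comp_apply]
  · have : a (N (J n + 1)) / c (N (J n + 1)) * (c (N (J n)) / c (N (J n + 1)))⁻¹ =
        a (N (J n + 1)) / c (N (J n)) := by
      field_simp
    rw [this]
    exact div_le_div₀ (ha0 _) (ha (hJ2 n)) (hc0 n) (hc (hJ1 n))
  · have : a (N (J n)) / c (N (J n)) * (c (N (J n)) / c (N (J n + 1))) =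
        a (N (J n)) / c (N (J n + 1)) := by
      field_simp
    rw [this]
    exact div_le_div₀ (ha0 _) (ha (hJ1 n)) h3 (hc (hJ2 n))

/-! ### Decay of the mean conductance. -/

namespace MarkedTree

variable {ρ : Measure ℕ} {μ : Measure ℝ≥0} [IsProbabilityMeasure ρ] [IsProbabilityMeasure μ]
  {m : ℝ≥0}

/-- The expectation of the conductance as a real number. -/
noncomputable def meanCond (m : ℝ≥0) (ρ : Measure ℕ) (μ : Measure ℝ≥0) (n : ℕ) : ℝ :=
  (∫⁻ τ, cond m n τ ∂law ρ μ).toReal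

/-- Indices start at `2`, where second moments are finite. With `b = E[ξ⁻¹]` bounding all these
means, `δ = E[ξ / (1 + ξ b)]` is finite by the mean of `ξ` and positive because `ξ` is not almost
surely zero. -/
theorem exists_meanCond_bounds (hm1 : 1 < m) (hm : ∫⁻ n : ℕ, (n : ℝ≥0∞) ∂ρ = m)
    (h2 : ∫⁻ n : ℕ, (n : ℝ≥0∞) ^ 2 ∂ρ < ⊤) (hmean : ∫⁻ x : ℝ≥0, (x : ℝ≥0∞) ∂μ < ⊤)
    (hmean0 : ∫⁻ x : ℝ≥0, (x : ℝ≥0∞) ∂μ ≠ 0)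
    (hinv : ∫⁻ x : ℝ≥0, (x : ℝ≥0∞)⁻¹ ∂μ < ⊤) :
    ∃ K > 0, ∀ n : ℕ, meanCond m ρ μ (n + 2) * (n + 1) ≤ K ∧
      (∫⁻ τ, cond m (n + 2) τ ^ 2 ∂law ρ μ).toReal ≤ K * meanCond m ρ μ (n + 2) ^ 2 ∧
      meanCond m ρ μ (n + 2) ≤
        meanCond m ρ μ (n + 1 + 2) * (1 + K * meanCond m ρ μ (n + 2)) := by
  have hm0 : m ≠ 0 := (zero_lt_one.trans hm1).ne'
  have hc := fun n => (lintegral_cond_succ_le (ρ := ρ) (μ := μ) hm0 hm n).trans_lt hinv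
  have hs := lintegral_sq_cond_lt_top (ρ := ρ) (μ := μ) hm0 hm h2 hinv
  have hκ := pairFactor_lt_top hm0 h2
  obtain ⟨b, hb⟩ : ∃ b : ℝ≥0, (b : ℝ≥0∞) = ∫⁻ x : ℝ≥0, (x : ℝ≥0∞)⁻¹ ∂μ :=
    ⟨_, ENNReal.coe_toNNReal hinv.ne⟩
  set Δ := ∫⁻ x : ℝ≥0, ((x / (1 + x * b) : ℝ≥0) : ℝ≥0∞) ∂μ with hΔ
  have hΔtop : Δ ≠ ⊤ := by
    refine ((lintegral_mono fun x => ?_).trans_lt hmean).ne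
    exact ENNReal.coe_le_coe.2 (div_le_self zero_le (by simp))
  have hΔ0 : Δ ≠ 0 := by
    contrapose! hmean0
    rw [hΔ, lintegral_eq_zero_iff (by fun_prop)] at hmean0
    rw [lintegral_eq_zero_iff (by fun_prop)]
    filter_upwards [hmean0] with x hx
    have hx' : x / (1 + x * b) = 0 := ENNReal.coe_eq_zero.1 hx
    rcases div_eq_zero_iff.1 hx' with h | h
    · simpa using h
    · exact absurd h (by positivity)
  refine exists_decay_bounds (c := fun n => meanCond m ρ μ (n + 2))
    (s := fun n => (∫⁻ τ, cond m (n + 2) τ ^ 2 ∂law ρ μ).toReal) (δ := Δ.toReal)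
    (E := (∫⁻ x : ℝ≥0, (x : ℝ≥0∞) ∂μ).toReal) (m := m) (κ := (pairFactor m ρ).toReal)
    (fun n => ENNReal.toReal_pos (lintegral_cond_ne_zero hm0 hm _) (hc (n + 1)).ne)
    (fun n => ENNReal.toReal_nonneg) (ENNReal.toReal_pos hΔ0 hΔtop) ENNReal.toReal_nonneg
    (by exact_mod_cast hm1) (fun n => ?_) (fun n => ?_) (fun n => ?_)
  · have h := lintegral_cond_succ_add_le (ρ := ρ) (μ := μ) hm0 hm (n := n + 2) (b := b)
      (hb ▸ lintegral_cond_succ_le hm0 hm (n + 1))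
    have h' := ENNReal.toReal_mono (hc (n + 1)).ne h
    rw [ENNReal.toReal_add (hc (n + 2)).ne
      (ENNReal.mul_ne_top hΔtop (ENNReal.pow_ne_top (hc (n + 1)).ne)), ENNReal.toReal_mul,
      ENNReal.toReal_pow] at h'
    exact h'
  · have h := sq_lintegral_cond_le (ρ := ρ) (μ := μ) hm0 hm (n := n + 2) (hc (n + 1)).ne
    have hfin := ENNReal.mul_ne_top hmean.ne (hs n).ne
    have h' := ENNReal.toReal_mono
      (ENNReal.mul_ne_top (hc (n + 2)).ne (ENNReal.add_ne_top.2 ⟨(hc (n + 1)).ne, hfin⟩)) h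
    rw [ENNReal.toReal_mul, ENNReal.toReal_add (hc (n + 1)).ne hfin, ENNReal.toReal_mul,
      ENNReal.toReal_pow] at h'
    exact h'
  · have h := lintegral_sq_cond_succ_mul_le (ρ := ρ) (μ := μ) hm0 hm (n := n + 2) (hc (n + 1)).ne
    have hf1 : (m : ℝ≥0∞)⁻¹ * ((∫⁻ τ, cond m (n + 2) τ ^ 2 ∂law ρ μ) *
        ∫⁻ τ, cond m (n + 2 + 1) τ ∂law ρ μ) ≠ ⊤ :=
      ENNReal.mul_ne_top (by simpa using hm0) (ENNReal.mul_ne_top (hs n).ne (hc (n + 2)).ne)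
    have hf2 : pairFactor m ρ * (∫⁻ τ, cond m (n + 2 + 1) τ ∂law ρ μ) ^ 2 *
        ∫⁻ τ, cond m (n + 2) τ ∂law ρ μ ≠ ⊤ :=
      ENNReal.mul_ne_top (ENNReal.mul_ne_top hκ.ne (ENNReal.pow_ne_top (hc (n + 2)).ne))
        (hc (n + 1)).ne
    have h' := ENNReal.toReal_mono (ENNReal.add_ne_top.2 ⟨hf1, hf2⟩) h
    rw [ENNReal.toReal_add hf1 hf2] at h'
    simp only [ENNReal.toReal_mul, ENNReal.toReal_pow, ENNReal.toReal_inv,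
      ENNReal.coe_toReal] at h'
    exact h'

end MarkedTree

/-! ### Almost sure convergence -/

/-- The squared distance of two finite extended nonnegative reals. -/
noncomputable def sqDist (a b : ℝ≥0∞) : ℝ≥0∞ := ENNReal.ofReal ((a.toReal - b.toReal) ^ 2)

/-- The cross term stands on the left because subtraction in `ℝ≥0∞` is truncated. -/
theorem sqDist_add {a b : ℝ≥0∞} (ha : a ≠ ⊤) (hb : b ≠ ⊤) :
    sqDist a b + 2 * (a * b) = a ^ 2 + b ^ 2 := by
  lift a to ℝ≥0 using ha
  lift b to ℝ≥0 using hb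
  rw [sqDist, ENNReal.coe_toReal, ENNReal.coe_toReal, ← ENNReal.ofReal_coe_nnreal (p := a),
    ← ENNReal.ofReal_coe_nnreal (p := b), ← ENNReal.ofReal_mul a.coe_nonneg,
    ← ENNReal.ofReal_ofNat, ← ENNReal.ofReal_mul (by norm_num), ← ENNReal.ofReal_pow a.coe_nonneg,
    ← ENNReal.ofReal_pow b.coe_nonneg, ← ENNReal.ofReal_add (sq_nonneg _) (by positivity),
    ← ENNReal.ofReal_add (by positivity) (by positivity)]
  congr 1
  ring

@[fun_prop]
theorem measurable_sqDist {α : Type*} [MeasurableSpace α] {f g : α → ℝ≥0∞} (hf : Measurable f)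
    (hg : Measurable g) : Measurable fun x => sqDist (f x) (g x) := by
  unfold sqDist
  fun_prop

theorem MeasureTheory.ae_tsum_ne_top {α : Type*} [MeasurableSpace α] {Q : Measure α}
    {f : ℕ → α → ℝ≥0∞} (hf : ∀ k, Measurable (f k)) (h : ∑' k, ∫⁻ x, f k x ∂Q ≠ ⊤) :
    ∀ᵐ x ∂Q, ∑' k, f k x ≠ ⊤ := by
  rw [← lintegral_tsum fun k => (hf k).aemeasurable] at h
  filter_upwards [ae_lt_top (Measurable.tsum hf) h] with x hx using hx.ne

theorem MeasureTheory.ae_ne_top_of_lintegral_sq {α : Type*} [MeasurableSpace α] {Q : Measure α}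
    {f : α → ℝ≥0∞} (hf : Measurable f) (h : ∫⁻ x, f x ^ 2 ∂Q ≠ ⊤) : ∀ᵐ x ∂Q, f x ≠ ⊤ := by
  filter_upwards [ae_lt_top (by fun_prop) h] with x hx h'
  simp [h'] at hx

theorem lintegral_sqDist_add {α : Type*} [MeasurableSpace α] {Q : Measure α}
    {f g : α → ℝ≥0∞} (hf : Measurable f) (hg : Measurable g)
    (hf2 : ∫⁻ x, f x ^ 2 ∂Q ≠ ⊤) (hg2 : ∫⁻ x, g x ^ 2 ∂Q ≠ ⊤) :
    ∫⁻ x, sqDist (f x) (g x) ∂Q + 2 * ∫⁻ x, f x * g x ∂Q =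
      ∫⁻ x, f x ^ 2 ∂Q + ∫⁻ x, g x ^ 2 ∂Q := by
  rw [← lintegral_const_mul _ (by fun_prop), ← lintegral_add_left (by fun_prop),
    ← lintegral_add_left (by fun_prop)]
  refine lintegral_congr_ae ?_
  filter_upwards [ae_ne_top_of_lintegral_sq hf hf2, ae_ne_top_of_lintegral_sq hg hg2] with x h1 h2
  exact sqDist_add h1 h2

/-! ### L² contraction of `childMean` and convergence of the level sizes. -/

namespace MarkedTree

theorem childMean_mul_const (m : ℝ≥0) (f : MarkedTree → ℝ≥0∞) (a : ℝ≥0∞) :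
    childMean m (fun τ => f τ * a) = fun τ => childMean m f τ * a := by
  funext τ
  rw [childMean, childMean, ← Finset.sum_mul, mul_assoc]

theorem iterate_childMean_mul_const (m : ℝ≥0) (k : ℕ) (f : MarkedTree → ℝ≥0∞) (a : ℝ≥0∞) :
    (childMean m)^[k] (fun τ => f τ * a) = fun τ => (childMean m)^[k] f τ * a := by
  induction k with
  | zero => rfl
  | succ k ih => rw [Function.iterate_succ_apply', ih, childMean_mul_const,
      Function.iterate_succ_apply']

variable {ρ : Measure ℕ} {μ : Measure ℝ≥0} [IsProbabilityMeasure ρ] [IsProbabilityMeasure μ]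
  {m : ℝ≥0}

theorem lintegral_iterate_childMean (hm0 : m ≠ 0) (hm : ∫⁻ n : ℕ, (n : ℝ≥0∞) ∂ρ = m) (k : ℕ)
    {f : MarkedTree → ℝ≥0∞} (hf : Measurable f) :
    ∫⁻ τ, (childMean m)^[k] f τ ∂law ρ μ = ∫⁻ τ, f τ ∂law ρ μ := by
  induction k with
  | zero => rfl
  | succ k ih =>
    rw [Function.iterate_succ_apply',
      lintegral_childMean hm0 hm (measurable_iterate_childMean m k hf), ih]

theorem lintegral_ne_top_of_lintegral_sq {f : MarkedTree → ℝ≥0∞}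
    (h : ∫⁻ τ, f τ ^ 2 ∂law ρ μ ≠ ⊤) : ∫⁻ τ, f τ ∂law ρ μ ≠ ⊤ := by
  have hle : ∫⁻ τ, f τ ∂law ρ μ ≤ ∫⁻ τ, (1 + f τ ^ 2) ∂law ρ μ := by
    refine lintegral_mono fun τ => ?_
    rcases le_total (f τ) 1 with h1 | h1
    · exact h1.trans le_self_add
    · exact (le_self_pow₀ h1 two_ne_zero).trans le_add_self
  refine ne_top_of_le_ne_top ?_ hle
  rw [lintegral_add_left measurable_const, lintegral_const, measure_univ]
  exact ENNReal.add_ne_top.2 ⟨by simp, h⟩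

theorem lintegral_sq_childMean_ne_top (hm0 : m ≠ 0) (hm : ∫⁻ n : ℕ, (n : ℝ≥0∞) ∂ρ = m)
    (h2 : ∫⁻ n : ℕ, (n : ℝ≥0∞) ^ 2 ∂ρ < ⊤) {f : MarkedTree → ℝ≥0∞} (hf : Measurable f)
    (hf2 : ∫⁻ τ, f τ ^ 2 ∂law ρ μ ≠ ⊤) : ∫⁻ τ, childMean m f τ ^ 2 ∂law ρ μ ≠ ⊤ := by
  have hf1 := lintegral_ne_top_of_lintegral_sq hf2
  simp_rw [sq] at hf2 ⊢
  rw [lintegral_childMean_mul_childMean hm0 hm hf hf]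
  exact ENNReal.add_ne_top.2 ⟨ENNReal.mul_ne_top (by simpa using hm0) hf2,
    ENNReal.mul_ne_top (pairFactor_lt_top hm0 h2).ne (ENNReal.mul_ne_top hf1 hf1)⟩

/-- In the three second moments the `pairFactor` terms involve only the means; when these are equal
they cancel, leaving the diagonal factor `m⁻¹`. -/
theorem lintegral_sqDist_childMean (hm0 : m ≠ 0) (hm : ∫⁻ n : ℕ, (n : ℝ≥0∞) ∂ρ = m)
    (h2 : ∫⁻ n : ℕ, (n : ℝ≥0∞) ^ 2 ∂ρ < ⊤) {f g : MarkedTree → ℝ≥0∞} (hf : Measurable f)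
    (hg : Measurable g) (hf2 : ∫⁻ τ, f τ ^ 2 ∂law ρ μ ≠ ⊤)
    (hg2 : ∫⁻ τ, g τ ^ 2 ∂law ρ μ ≠ ⊤)
    (hfg : ∫⁻ τ, f τ ∂law ρ μ = ∫⁻ τ, g τ ∂law ρ μ) :
    ∫⁻ τ, sqDist (childMean m f τ) (childMean m g τ) ∂law ρ μ =
      (m : ℝ≥0∞)⁻¹ * ∫⁻ τ, sqDist (f τ) (g τ) ∂law ρ μ := by
  have hmf := lintegral_sq_childMean_ne_top (μ := μ) hm0 hm h2 hf hf2
  have hmg := lintegral_sq_childMean_ne_top (μ := μ) hm0 hm h2 hg hg2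
  have e1 := lintegral_sqDist_add hf hg hf2 hg2
  have e2 := lintegral_sqDist_add (measurable_childMean m hf) (measurable_childMean m hg) hmf hmg
  -- The cross moment is finite, hence may be added to both sides and cancelled.
  have hfin : 2 * ∫⁻ τ, childMean m f τ * childMean m g τ ∂law ρ μ ≠ ⊤ :=
    ne_top_of_le_ne_top (ENNReal.add_ne_top.2 ⟨hmf, hmg⟩) (e2 ▸ le_add_self)
  rw [← ENNReal.add_left_inj hfin, e2]
  simp_rw [sq] at e1 ⊢
  rw [lintegral_childMean_mul_childMean hm0 hm hf hf,
    lintegral_childMean_mul_childMean hm0 hm hg hg,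
    lintegral_childMean_mul_childMean hm0 hm hf hg, hfg]
  calc _ = (m : ℝ≥0∞)⁻¹ * (∫⁻ τ, f τ * f τ ∂law ρ μ + ∫⁻ τ, g τ * g τ ∂law ρ μ) +
        2 * (pairFactor m ρ * ((∫⁻ τ, g τ ∂law ρ μ) * ∫⁻ τ, g τ ∂law ρ μ)) := by ring
    _ = _ := by
      rw [← e1]
      ring

theorem lintegral_sqDist_iterate_childMean (hm0 : m ≠ 0) (hm : ∫⁻ n : ℕ, (n : ℝ≥0∞) ∂ρ = m)
    (h2 : ∫⁻ n : ℕ, (n : ℝ≥0∞) ^ 2 ∂ρ < ⊤) (k : ℕ) {f g : MarkedTree → ℝ≥0∞}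
    (hf : Measurable f) (hg : Measurable g) (hf2 : ∫⁻ τ, f τ ^ 2 ∂law ρ μ ≠ ⊤)
    (hg2 : ∫⁻ τ, g τ ^ 2 ∂law ρ μ ≠ ⊤)
    (hfg : ∫⁻ τ, f τ ∂law ρ μ = ∫⁻ τ, g τ ∂law ρ μ) :
    ∫⁻ τ, sqDist ((childMean m)^[k] f τ) ((childMean m)^[k] g τ) ∂law ρ μ =
      (m : ℝ≥0∞)⁻¹ ^ k * ∫⁻ τ, sqDist (f τ) (g τ) ∂law ρ μ := by
  induction k generalizing f g with
  | zero => simp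
  | succ k ih =>
    simp only [Function.iterate_succ_apply]
    rw [ih (measurable_childMean m hf) (measurable_childMean m hg)
      (lintegral_sq_childMean_ne_top hm0 hm h2 hf hf2)
      (lintegral_sq_childMean_ne_top hm0 hm h2 hg hg2)
      (by rw [lintegral_childMean hm0 hm hf, lintegral_childMean hm0 hm hg, hfg]),
      lintegral_sqDist_childMean hm0 hm h2 hf hg hf2 hg2 hfg, pow_succ, mul_assoc]

theorem tsum_inv_pow_ne_top (hm1 : 1 < m) : ∑' k : ℕ, (m : ℝ≥0∞)⁻¹ ^ k ≠ ⊤ := by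
  rw [ENNReal.tsum_geometric, ENNReal.inv_ne_top, ← pos_iff_ne_zero, tsub_pos_iff_lt,
    ENNReal.inv_lt_one]
  exact_mod_cast hm1

theorem ae_iterate_childMean_one_ne_top (hm0 : m ≠ 0) (hm : ∫⁻ n : ℕ, (n : ℝ≥0∞) ∂ρ = m) :
    ∀ᵐ τ ∂law ρ μ, ∀ k, (childMean m)^[k] 1 τ ≠ ⊤ := by
  rw [ae_all_iff]
  intro k
  have hmeas := measurable_iterate_childMean m k (measurable_one (α := ℝ≥0∞) (β := MarkedTree))
  have hint : ∫⁻ τ, (childMean m)^[k] 1 τ ∂law ρ μ ≠ ⊤ := by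
    rw [lintegral_iterate_childMean hm0 hm k measurable_one]
    simp
  filter_upwards [ae_lt_top hmeas hint] with τ hτ using hτ.ne

/-- The normalized level sizes converge. -/
theorem ae_tendsto_iterate_childMean_one (hm1 : 1 < m) (hm : ∫⁻ n : ℕ, (n : ℝ≥0∞) ∂ρ = m)
    (h2 : ∫⁻ n : ℕ, (n : ℝ≥0∞) ^ 2 ∂ρ < ⊤) :
    ∀ᵐ τ ∂law ρ μ, ∃ w : ℝ,
      Tendsto (fun k => ((childMean m)^[k] 1 τ).toReal) atTop (𝓝 w) := by
  have hm0 : m ≠ 0 := (zero_lt_one.trans hm1).ne'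
  have hone : Measurable (1 : MarkedTree → ℝ≥0∞) := measurable_one
  have hone2 : ∫⁻ τ, (1 : MarkedTree → ℝ≥0∞) τ ^ 2 ∂law ρ μ ≠ ⊤ := by simp
  have hsucc2 := lintegral_sq_childMean_ne_top (μ := μ) hm0 hm h2 hone hone2
  set A := ∫⁻ τ, sqDist ((1 : MarkedTree → ℝ≥0∞) τ) (childMean m 1 τ) ∂law ρ μ with hA
  have hAtop : A ≠ ⊤ := by
    refine ne_top_of_le_ne_top (ENNReal.add_ne_top.2 ⟨hone2, hsucc2⟩) ?_
    rw [← lintegral_sqDist_add hone (measurable_childMean m hone) hone2 hsucc2]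
    exact le_self_add
  -- Any `l` strictly between `1` and `m` serves: the squared increments weighted by `l ^ k` have
  -- expectations of order `(l / m) ^ k`, while `∑ l⁻¹ ^ k` still converges.
  set l : ℝ≥0 := (1 + m) / 2 with hl
  have hl1 : 1 < l := by rw [hl, lt_div_iff₀ two_pos]; linarith
  have hlm : l < m := by rw [hl, div_lt_iff₀ two_pos]; linarith
  set d : ℕ → MarkedTree → ℝ := fun k τ =>
    ((childMean m)^[k] 1 τ).toReal - ((childMean m)^[k + 1] 1 τ).toReal with hd
  have hsum : ∑' k, ∫⁻ τ, (l : ℝ≥0∞) ^ k *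
      sqDist ((childMean m)^[k] 1 τ) ((childMean m)^[k + 1] 1 τ) ∂law ρ μ ≠ ⊤ := by
    have : ∀ k, ∫⁻ τ, (l : ℝ≥0∞) ^ k *
        sqDist ((childMean m)^[k] 1 τ) ((childMean m)^[k + 1] 1 τ) ∂law ρ μ =
        ((l / m : ℝ≥0) : ℝ≥0∞) ^ k * A := by
      intro k
      rw [lintegral_const_mul _ (measurable_sqDist (measurable_iterate_childMean m k hone)
        (measurable_iterate_childMean m (k + 1) hone))]
      simp only [Function.iterate_succ_apply]
      rw [lintegral_sqDist_iterate_childMean hm0 hm h2 k hone (measurable_childMean m hone)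
        hone2 hsucc2 (lintegral_childMean hm0 hm hone).symm, ← hA, ← mul_assoc, ← mul_pow,
        ← ENNReal.coe_inv hm0, ← ENNReal.coe_mul, div_eq_mul_inv]
    simp_rw [this]
    rw [ENNReal.tsum_mul_right, ENNReal.tsum_geometric]
    refine ENNReal.mul_ne_top (ENNReal.inv_ne_top.2 ?_) hAtop
    rw [← pos_iff_ne_zero, tsub_pos_iff_lt]
    exact_mod_cast (div_lt_one (zero_lt_one.trans hm1)).2 hlm
  filter_upwards [ae_tsum_ne_top (fun k => Measurable.const_mul (measurable_sqDist
    (measurable_iterate_childMean m k hone) (measurable_iterate_childMean m (k + 1) hone)) _)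
    hsum] with τ hτ
  have hS : Summable fun k => (l : ℝ) ^ k * d k τ ^ 2 := by
    refine (ENNReal.summable_toReal hτ).congr fun k => ?_
    rw [ENNReal.toReal_mul, ENNReal.toReal_pow, ENNReal.coe_toReal, sqDist,
      ENNReal.toReal_ofReal (sq_nonneg _)]
  have hgeo : Summable fun k => ((l : ℝ)⁻¹) ^ k :=
    summable_geometric_of_lt_one (by positivity) (inv_lt_one_of_one_lt₀ (by exact_mod_cast hl1))
  have hl0 : (0 : ℝ) < l := by exact_mod_cast zero_lt_one.trans hl1
  have hdist : Summable fun k => dist ((childMean m)^[k] 1 τ).toReal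
      ((childMean m)^[k + 1] 1 τ).toReal := by
    refine Summable.of_nonneg_of_le (fun _ => dist_nonneg) (fun k => ?_) (hgeo.add hS)
    rw [Real.dist_eq, inv_pow]
    change |d k τ| ≤ _
    have hy : 0 < (l : ℝ) ^ k := by positivity
    set y := (l : ℝ) ^ k
    -- Divided by `y = l ^ k`, this bounds the increment by `l⁻¹ ^ k + l ^ k d²`, a sum of two
    -- summable terms.
    have : y * |d k τ| ≤ 1 + y ^ 2 * |d k τ| ^ 2 := by
      nlinarith [sq_nonneg (1 - y * |d k τ|), mul_nonneg hy.le (abs_nonneg (d k τ))]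
    refine le_of_mul_le_mul_left (this.trans_eq ?_) hy
    rw [sq_abs]
    field_simp
  exact cauchySeq_tendsto_of_complete (cauchySeq_of_summable_dist hdist)

end MarkedTree

/-! ### Convergence of the normalized conductances. -/

namespace MarkedTree

section Convergence

variable {ρ : Measure ℕ} {μ : Measure ℝ≥0} [IsProbabilityMeasure ρ] [IsProbabilityMeasure μ]
  {m : ℝ≥0}

theorem summable_div_cube : Summable fun j : ℕ => (j : ℝ) / (j ^ 3 + 1) := by
  refine Summable.of_nonneg_of_le (fun j => by positivity) (fun j => ?_)
    (Real.summable_one_div_nat_pow.2 one_lt_two)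
  rcases Nat.eq_zero_or_pos j with rfl | hj
  · simp
  · have : (0 : ℝ) < j := by exact_mod_cast hj
    rw [div_le_div_iff₀ (by positivity) (by positivity)]
    nlinarith

/-- Averages of the conductances of the subtrees rooted at a level that is large but of smaller
order than the height are close to the normalized size of that level. -/
theorem ae_tendsto_iterate_childMean_sub (hm1 : 1 < m) (hm : ∫⁻ n : ℕ, (n : ℝ≥0∞) ∂ρ = m)
    (h2 : ∫⁻ n : ℕ, (n : ℝ≥0∞) ^ 2 ∂ρ < ⊤) {f : ℕ → MarkedTree → ℝ≥0∞}
    (hf : ∀ j, Measurable (f j)) (hf1 : ∀ j, ∫⁻ τ, f j τ ∂law ρ μ = 1) {K : ℝ≥0∞} (hK : K ≠ ⊤)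
    (hfK : ∀ j, ∫⁻ τ, f j τ ^ 2 ∂law ρ μ ≤ K) :
    ∀ᵐ τ ∂law ρ μ, Tendsto (fun j => ((childMean m)^[j] (f j) τ).toReal -
      ((childMean m)^[j] 1 τ).toReal) atTop (𝓝 0) := by
  have hm0 : m ≠ 0 := (zero_lt_one.trans hm1).ne'
  have hone : Measurable (1 : MarkedTree → ℝ≥0∞) := measurable_one
  have hone2 : ∫⁻ τ, (1 : MarkedTree → ℝ≥0∞) τ ^ 2 ∂law ρ μ ≠ ⊤ := by simp
  have hf2 : ∀ j, ∫⁻ τ, f j τ ^ 2 ∂law ρ μ ≠ ⊤ := fun j => ne_top_of_le_ne_top hK (hfK j)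
  have hmeas : ∀ j, Measurable fun τ =>
      sqDist ((childMean m)^[j] (f j) τ) ((childMean m)^[j] 1 τ) := fun j =>
    measurable_sqDist (measurable_iterate_childMean m j (hf j))
      (measurable_iterate_childMean m j hone)
  have hsum : ∑' j, ∫⁻ τ, sqDist ((childMean m)^[j] (f j) τ) ((childMean m)^[j] 1 τ) ∂law ρ μ ≠
      ⊤ := by
    refine ne_top_of_le_ne_top (ENNReal.mul_ne_top (tsum_inv_pow_ne_top hm1)
      (ENNReal.add_ne_top.2 ⟨hK, ENNReal.one_ne_top⟩)) ?_
    rw [← ENNReal.tsum_mul_right]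
    refine ENNReal.tsum_le_tsum fun j => ?_
    rw [lintegral_sqDist_iterate_childMean hm0 hm h2 j (hf j) hone (hf2 j) hone2
      (by simp [hf1])]
    gcongr
    calc ∫⁻ τ, sqDist (f j τ) ((1 : MarkedTree → ℝ≥0∞) τ) ∂law ρ μ
        ≤ ∫⁻ τ, f j τ ^ 2 ∂law ρ μ + ∫⁻ τ, (1 : MarkedTree → ℝ≥0∞) τ ^ 2 ∂law ρ μ := by
          rw [← lintegral_sqDist_add (hf j) hone (hf2 j) hone2]
          exact le_self_add
      _ ≤ K + 1 := add_le_add (hfK j) (by simp)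
  filter_upwards [ae_tsum_ne_top hmeas hsum] with τ hτ
  have h0 := (ENNReal.tendsto_toReal ENNReal.zero_ne_top).comp
    (ENNReal.tendsto_atTop_zero_of_tsum_ne_top hτ)
  have h1 := (Real.continuous_sqrt.tendsto 0).comp h0
  rw [Real.sqrt_zero] at h1
  rw [tendsto_zero_iff_abs_tendsto_zero]
  refine h1.congr fun j => ?_
  simp only [Function.comp_apply, sqDist]
  rw [ENNReal.toReal_ofReal (sq_nonneg _), Real.sqrt_sq_eq_abs]

/-- The ratio of the conductance to its mean converges to the limit of the normalized level
sizes. -/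
theorem ae_tendsto_cond_div (hm1 : 1 < m) (hm : ∫⁻ n : ℕ, (n : ℝ≥0∞) ∂ρ = m)
    (h2 : ∫⁻ n : ℕ, (n : ℝ≥0∞) ^ 2 ∂ρ < ⊤) (hmean : ∫⁻ x : ℝ≥0, (x : ℝ≥0∞) ∂μ < ⊤)
    (hmean0 : ∫⁻ x : ℝ≥0, (x : ℝ≥0∞) ∂μ ≠ 0)
    (hinv : ∫⁻ x : ℝ≥0, (x : ℝ≥0∞)⁻¹ ∂μ < ⊤) :
    ∀ᵐ τ ∂law ρ μ, ∃ w : ℝ≥0,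
      Tendsto (fun k => (childMean m)^[k] 1 τ) atTop (𝓝 (w : ℝ≥0∞)) ∧
      Tendsto (fun n => cond m n τ / ∫⁻ τ', cond m n τ' ∂law ρ μ) atTop (𝓝 (w : ℝ≥0∞)) := by
  have hm0 : m ≠ 0 := (zero_lt_one.trans hm1).ne'
  obtain ⟨K, hK0, hK⟩ := exists_meanCond_bounds (ρ := ρ) (μ := μ) hm1 hm h2 hmean hmean0 hinv
  -- The shift by `2` reaches the range where the moment bounds hold.
  set c : ℕ → ℝ := fun n => meanCond m ρ μ (n + 2) with hc
  set E : ℕ → ℝ≥0∞ := fun n => ∫⁻ τ, cond m (n + 2) τ ∂law ρ μ with hE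
  have hEtop : ∀ n, E n ≠ ⊤ := fun n =>
    ((lintegral_cond_succ_le hm0 hm (n + 1)).trans_lt hinv).ne
  have hE0 : ∀ n, E n ≠ 0 := fun n => lintegral_cond_ne_zero hm0 hm _
  have hEc : ∀ n, (E n).toReal = c n := fun n => rfl
  have hc0 : ∀ n, 0 < c n := fun n => ENNReal.toReal_pos (hE0 n) (hEtop n)
  have hEanti : Antitone E := fun i j hij =>
    lintegral_mono (cond_antitone m (by lia : i + 2 ≤ j + 2))
  have hcanti : Antitone c := fun i j hij => ENNReal.toReal_mono (hEtop i) (hEanti hij)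
  have hratio : ∀ n k, c n / c (n + k) ≤ 1 + K * k * c n :=
    div_le_one_add_mul_of_le hK0.le hc0 fun n => (hK n).2.2
  have hratio1 : ∀ n k, 1 ≤ c n / c (n + k) := fun n k =>
    (one_le_div (hc0 _)).2 (hcanti (Nat.le_add_right n k))
  have hcK : ∀ n : ℕ, c n ≤ K / (n + 1) := fun n =>
    (le_div_iff₀ (by positivity)).2 (hK n).1
  -- The height `j³` makes the relative loss over `j` further levels summable in `j`.
  have hcube : ∀ j : ℕ, K * j * c (j ^ 3) ≤ K ^ 2 * (j / (j ^ 3 + 1)) := fun j => by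
    have := hcK (j ^ 3)
    push_cast at this
    calc K * j * c (j ^ 3) ≤ K * j * (K / (j ^ 3 + 1)) := by gcongr
      _ = _ := by ring
  have hfin : ∀ᵐ τ ∂law ρ μ, ∀ n, cond m (n + 2) τ ≠ ⊤ := by
    rw [ae_all_iff]
    intro n
    filter_upwards [ae_lt_top (measurable_cond m (n + 2)) (hEtop n)] with τ hτ using hτ.ne
  have hfin' : ∀ᵐ τ ∂law ρ μ, ∀ j, (childMean m)^[j] (cond m (j ^ 3 + 2)) τ ≠ ⊤ := by
    rw [ae_all_iff]
    intro j
    have : ∫⁻ τ, (childMean m)^[j] (cond m (j ^ 3 + 2)) τ ∂law ρ μ ≠ ⊤ := by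
      rw [lintegral_iterate_childMean hm0 hm j (measurable_cond m _)]
      exact hEtop _
    filter_upwards [ae_lt_top (measurable_iterate_childMean m j (measurable_cond m _)) this]
      with τ hτ using hτ.ne
  have hle : ∀ j, cond m (j ^ 3 + j + 2) ≤ (childMean m)^[j] (cond m (j ^ 3 + 2)) := fun j => by
    have := cond_add_le m (j ^ 3 + 2) j
    rwa [add_right_comm] at this
  -- The conductances divided by their means have mean `1`, and `s ≤ K c²` bounds their second
  -- moments uniformly.
  have havg := ae_tendsto_iterate_childMean_sub (μ := μ) hm1 hm h2
    (f := fun j τ => cond m (j ^ 3 + 2) τ * (E (j ^ 3))⁻¹) (fun j => by fun_prop)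
    (fun j => by
      rw [lintegral_mul_const _ (by fun_prop)]
      exact ENNReal.mul_inv_cancel (hE0 _) (hEtop _))
    (K := ENNReal.ofReal K) ENNReal.ofReal_ne_top (fun j => by
      have hsq := lintegral_sq_cond_lt_top (ρ := ρ) (μ := μ) hm0 hm h2 hinv (j ^ 3)
      simp_rw [mul_pow]
      rw [lintegral_mul_const _ (by fun_prop)]
      have hne : (∫⁻ τ, cond m (j ^ 3 + 2) τ ^ 2 ∂law ρ μ) * (E (j ^ 3))⁻¹ ^ 2 ≠ ⊤ :=
        ENNReal.mul_ne_top hsq.ne (ENNReal.pow_ne_top (ENNReal.inv_ne_top.2 (hE0 _)))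
      refine (ENNReal.le_ofReal_iff_toReal_le hne hK0.le).2 ?_
      rw [ENNReal.toReal_mul, ENNReal.toReal_pow, ENNReal.toReal_inv, hEc, inv_pow,
        ← div_eq_mul_inv, div_le_iff₀ (pow_pos (hc0 _) 2)]
      exact (hK (j ^ 3)).2.1)
  -- The differences are nonnegative by `cond_add_le`, so their L¹ norms are mere differences of
  -- means and no variance estimate is needed.
  have hdiffsum : ∑' j, ∫⁻ τ, ((childMean m)^[j] (cond m (j ^ 3 + 2)) τ -
      cond m (j ^ 3 + j + 2) τ) * (E (j ^ 3))⁻¹ ∂law ρ μ ≠ ⊤ := by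
    have hterm : ∀ j, ∫⁻ τ, ((childMean m)^[j] (cond m (j ^ 3 + 2)) τ -
        cond m (j ^ 3 + j + 2) τ) * (E (j ^ 3))⁻¹ ∂law ρ μ ≤
        ENNReal.ofReal (K ^ 2 * (j / (j ^ 3 + 1))) := by
      intro j
      have hmeas := measurable_iterate_childMean m j (measurable_cond m (j ^ 3 + 2))
      rw [lintegral_mul_const _ (by fun_prop), lintegral_sub (measurable_cond m _)
        (hEtop (j ^ 3 + j)) (ae_of_all _ (hle j)),
        lintegral_iterate_childMean hm0 hm j (measurable_cond m _)]
      change (E (j ^ 3) - E (j ^ 3 + j)) * (E (j ^ 3))⁻¹ ≤ _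
      refine (ENNReal.le_ofReal_iff_toReal_le
        (ENNReal.mul_ne_top (ENNReal.sub_ne_top (hEtop _)) (ENNReal.inv_ne_top.2 (hE0 _)))
        (by positivity)).2 ((le_trans ?_ (hcube j)))
      rw [ENNReal.toReal_mul, ENNReal.toReal_sub_of_le (hEanti (Nat.le_add_right _ _)) (hEtop _),
        ENNReal.toReal_inv, hEc, hEc, ← div_eq_mul_inv]
      have h3 := hratio (j ^ 3) j
      have h4 := hc0 (j ^ 3)
      have h5 := hc0 (j ^ 3 + j)
      have h6 := hratio1 (j ^ 3) j
      have h7 : (c (j ^ 3) - c (j ^ 3 + j)) / c (j ^ 3) =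
          1 - (c (j ^ 3) / c (j ^ 3 + j))⁻¹ := by
        field_simp
      rw [h7]
      set q := c (j ^ 3) / c (j ^ 3 + j)
      have h8 : q * q⁻¹ = 1 := mul_inv_cancel₀ (by positivity)
      have h9 : 0 < q⁻¹ := by positivity
      -- For `q ≥ 1` one has `1 - q⁻¹ ≤ q - 1`, and `h3` bounds the right side.
      nlinarith [mul_nonneg (sub_nonneg.2 h6) (sub_nonneg.2 h6)]
    refine ne_top_of_le_ne_top ?_ (ENNReal.tsum_le_tsum hterm)
    rw [← ENNReal.ofReal_tsum_of_nonneg (fun j => by positivity)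
      (summable_div_cube.mul_left _)]
    exact ENNReal.ofReal_ne_top
  have hdiff := ae_tsum_ne_top (fun j => by
    have := measurable_iterate_childMean m j (measurable_cond m (j ^ 3 + 2))
    fun_prop) hdiffsum
  have hratioN : Tendsto (fun j : ℕ => c (j ^ 3) / c (j ^ 3 + j)) atTop (𝓝 1) := by
    have h3 : Tendsto (fun j : ℕ => 1 + K ^ 2 * ((j : ℝ) / (j ^ 3 + 1))) atTop (𝓝 1) := by
      simpa using (summable_div_cube.tendsto_atTop_zero.const_mul (K ^ 2)).const_add 1
    exact tendsto_of_tendsto_of_tendsto_of_le_of_le tendsto_const_nhds h3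
      (fun j => hratio1 _ _) fun j => (hratio _ _).trans (by simpa using hcube j)
  -- The gaps of the subsequence are of order `j²` while `c` is of order at most `j⁻³` there, so
  -- consecutive means have ratio tending to `1`.
  have hratioS : Tendsto (fun j : ℕ => c (j ^ 3 + j) / c ((j + 1) ^ 3 + (j + 1))) atTop
      (𝓝 1) := by
    have h3 : Tendsto (fun j : ℕ => 1 + K ^ 2 * 8 * (1 / ((j : ℝ) + 1))) atTop (𝓝 1) := by
      have := ((tendsto_one_div_add_atTop_nhds_zero_nat (𝕜 := ℝ)).const_mul (K ^ 2 * 8)).const_add 1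
      rwa [mul_zero, add_zero] at this
    have hN : ∀ j : ℕ, (j + 1) ^ 3 + (j + 1) = j ^ 3 + j + (3 * j ^ 2 + 3 * j + 2) := fun j => by
      ring
    refine tendsto_of_tendsto_of_tendsto_of_le_of_le tendsto_const_nhds h3
      (fun j => hN j ▸ hratio1 _ _) fun j => ?_
    simp only [hN]
    refine (hratio _ _).trans ?_
    have h4 := hcK (j ^ 3 + j)
    push_cast at h4 ⊢
    have h5 : (3 * (j : ℝ) ^ 2 + 3 * j + 2) / (j ^ 3 + j + 1) ≤ 8 * (1 / (j + 1)) := by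
      rw [mul_one_div, div_le_div_iff₀ (by positivity) (by positivity)]
      have hj : (0 : ℝ) ≤ j := j.cast_nonneg
      nlinarith [mul_nonneg hj (sq_nonneg ((j : ℝ) - 1))]
    calc 1 + K * (3 * (j : ℝ) ^ 2 + 3 * j + 2) * c (j ^ 3 + j)
        ≤ 1 + K * (3 * (j : ℝ) ^ 2 + 3 * j + 2) * (K / (j ^ 3 + j + 1)) := by gcongr
      _ = 1 + K ^ 2 * ((3 * (j : ℝ) ^ 2 + 3 * j + 2) / (j ^ 3 + j + 1)) := by ring
      _ ≤ 1 + K ^ 2 * (8 * (1 / (j + 1))) := by gcongr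
      _ = _ := by ring
  filter_upwards [ae_tendsto_iterate_childMean_one (ρ := ρ) (μ := μ) hm1 hm h2,
    ae_iterate_childMean_one_ne_top (ρ := ρ) (μ := μ) hm0 hm, hfin, hfin', havg, hdiff]
    with τ ⟨w, hw⟩ hwfin hfin hfin' havg hdiff
  have hw0 : 0 ≤ w := ge_of_tendsto' hw fun k => ENNReal.toReal_nonneg
  lift w to ℝ≥0 using hw0
  refine ⟨w, ?_, ?_⟩
  · rw [← ENNReal.ofReal_coe_nnreal]
    refine ((ENNReal.continuous_ofReal.tendsto _).comp hw).congr fun k => ?_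
    exact ENNReal.ofReal_toReal (hwfin k)
  have hA : Tendsto (fun j : ℕ => ((childMean m)^[j] (cond m (j ^ 3 + 2)) τ).toReal / c (j ^ 3))
      atTop (𝓝 w) := by
    have := havg.add hw
    rw [zero_add] at this
    refine this.congr fun j => ?_
    rw [sub_add_cancel, iterate_childMean_mul_const, ENNReal.toReal_mul, ENNReal.toReal_inv, hEc,
      div_eq_mul_inv]
  have hD : Tendsto (fun j : ℕ => (((childMean m)^[j] (cond m (j ^ 3 + 2)) τ).toReal -
      (cond m (j ^ 3 + j + 2) τ).toReal) / c (j ^ 3)) atTop (𝓝 0) := by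
    have := (ENNReal.tendsto_toReal ENNReal.zero_ne_top).comp
      (ENNReal.tendsto_atTop_zero_of_tsum_ne_top hdiff)
    refine this.congr fun j => ?_
    rw [Function.comp_apply, ENNReal.toReal_mul, ENNReal.toReal_sub_of_le (hle j τ) (hfin' j),
      ENNReal.toReal_inv, hEc, div_eq_mul_inv]
  have hB : Tendsto (fun j : ℕ => (cond m (j ^ 3 + j + 2) τ).toReal / c (j ^ 3 + j)) atTop
      (𝓝 w) := by
    have := (hA.sub hD).mul hratioN
    rw [sub_zero, mul_one] at this
    refine this.congr fun j => ?_
    have h4 := hc0 (j ^ 3)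
    have h5 := hc0 (j ^ 3 + j)
    field_simp
    ring
  -- Conductances and their means both decrease with the height, so the subsequence controls all
  -- indices.
  have hfull : Tendsto (fun n => (cond m (n + 2) τ).toReal / c n) atTop (𝓝 w) := by
    refine tendsto_div_of_antitone_of_subseq (N := fun j => j ^ 3 + j)
      (fun i j hij => ENNReal.toReal_mono (hfin i) (cond_antitone m (by lia : i + 2 ≤ j + 2) τ))
      hcanti (fun n => ENNReal.toReal_nonneg) hc0 ?_ (by simp) hB hratioS
    exact strictMono_nat_of_lt_succ fun j => by
      have : j ^ 3 ≤ (j + 1) ^ 3 := Nat.pow_le_pow_left (Nat.le_succ j) 3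
      lia
  rw [← tendsto_add_atTop_iff_nat 2, ← ENNReal.ofReal_coe_nnreal]
  refine ((ENNReal.continuous_ofReal.tendsto _).comp hfull).congr fun n => ?_
  rw [Function.comp_apply, ENNReal.ofReal_div_of_pos (hc0 n), ENNReal.ofReal_toReal (hfin n),
    ← hEc, ENNReal.ofReal_toReal (hEtop n)]

end Convergence

end MarkedTree

/-! ### From the canonical space to branching networks -/

namespace MarkedTree

/-- Replace the mark of the root by `0`. -/
noncomputable def clearRoot (τ : MarkedTree) : MarkedTree :=
  (τ.1, extendMarks fun u => τ.2 u)

theorem measurable_clearRoot : Measurable clearRoot := by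
  unfold clearRoot
  fun_prop

theorem RootFree.clearRoot {α : Type*} {f : MarkedTree → α} (hf : RootFree f) (τ : MarkedTree) :
    f τ.clearRoot = f τ :=
  hf τ.1 _ _ fun _ hu => extendMarks_of_ne _ hu

theorem rootFree_iterate_childMean_one (m : ℝ≥0) (k : ℕ) : RootFree ((childMean m)^[k] 1) := by
  cases k with
  | zero => intro _ _ _ _; rfl
  | succ k =>
    rw [Function.iterate_succ_apply']
    exact rootFree_childMean m _

theorem map_clearRoot_law (ρ : Measure ℕ) (μ : Measure ℝ≥0) [IsProbabilityMeasure ρ]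
    [IsProbabilityMeasure μ] :
    (law ρ μ).map clearRoot =
      ((Measure.infinitePi fun _ => ρ).prod (Measure.infinitePi fun _ => μ)).map
        (Prod.map id extendMarks) := by
  have h : clearRoot = Prod.map id extendMarks ∘
      Prod.map id (fun (ξ : List ℕ → ℝ≥0) (u : {u : List ℕ // u ≠ []}) => ξ u) := rfl
  rw [h, ← Measure.map_map (by fun_prop) (by fun_prop), law,
    ← Measure.map_prod_map _ _ measurable_id (by fun_prop), Measure.map_id,
    map_restrict_infinitePi]

end MarkedTree

namespace IsBranchingNetwork

open MarkedTree

variable {Ω : Type*} [MeasurableSpace Ω] {P : Measure Ω} {p : PMF ℕ}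
  {ξ₀ : Ω → ℝ≥0} {N : List ℕ → Ω → ℕ} {ξ : List ℕ → Ω → ℝ≥0}

/-- The marked tree of a branching network. -/
def tree (N : List ℕ → Ω → ℕ) (ξ : List ℕ → Ω → ℝ≥0) (ω : Ω) : MarkedTree :=
  (fun u => N u ω, fun u => ξ u ω)

theorem aemeasurable_mark (h : IsBranchingNetwork P p ξ₀ N ξ) : AEMeasurable ξ₀ P :=
  (h.mark_identDistrib [0] (by simp)).aemeasurable_snd

theorem hasLaw_mark (h : IsBranchingNetwork P p ξ₀ N ξ) (x : {x : List ℕ // x ≠ []}) :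
    HasLaw (ξ x) (P.map ξ₀) P :=
  ⟨(h.mark_identDistrib x x.2).aemeasurable_fst, (h.mark_identDistrib x x.2).map_eq⟩

theorem aemeasurable_offspring (h : IsBranchingNetwork P p ξ₀ N ξ) :
    AEMeasurable (fun ω u => N u ω) P :=
  aemeasurable_pi_iff.2 fun u => (h.offspring_law u).aemeasurable

theorem aemeasurable_marks (h : IsBranchingNetwork P p ξ₀ N ξ) :
    AEMeasurable (fun ω (x : {x : List ℕ // x ≠ []}) => ξ x ω) P :=
  aemeasurable_pi_iff.2 fun x => (h.hasLaw_mark x).aemeasurable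

theorem aemeasurable_clearRoot_tree (h : IsBranchingNetwork P p ξ₀ N ξ) :
    AEMeasurable (fun ω => (tree N ξ ω).clearRoot) P :=
  h.aemeasurable_offspring.prodMk (measurable_extendMarks.comp_aemeasurable h.aemeasurable_marks)

/-- Nothing is assumed about the mark `ξ []`, not even measurability, so the laws can be compared
only after clearing it. -/
theorem map_clearRoot_tree [IsProbabilityMeasure P] (h : IsBranchingNetwork P p ξ₀ N ξ) :
    P.map (fun ω => (tree N ξ ω).clearRoot) = (law p.toMeasure (P.map ξ₀)).map clearRoot := by
  have := Measure.isProbabilityMeasure_map h.aemeasurable_mark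
  have h1 := h.offspring_indep_mark.map_prod_eq_prod_map_map h.aemeasurable_offspring
    h.aemeasurable_marks
  rw [(h.offspring_indep.hasLaw_infinitePi h.offspring_law h.aemeasurable_offspring).map_eq,
    (h.mark_indep.hasLaw_infinitePi h.hasLaw_mark h.aemeasurable_marks).map_eq] at h1
  rw [map_clearRoot_law, ← h1, AEMeasurable.map_map_of_aemeasurable
    (Measurable.aemeasurable (by fun_prop)) (h.aemeasurable_offspring.prodMk h.aemeasurable_marks)]
  rfl

theorem ae_tree_of_ae_law [IsProbabilityMeasure P] (h : IsBranchingNetwork P p ξ₀ N ξ)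
    {q : MarkedTree → Prop} (hq : MeasurableSet {τ | q τ}) (hfree : RootFree q)
    (hae : ∀ᵐ τ ∂law p.toMeasure (P.map ξ₀), q τ) : ∀ᵐ ω ∂P, q (tree N ξ ω) := by
  have h1 : ∀ᵐ τ ∂(law p.toMeasure (P.map ξ₀)).map clearRoot, q τ := by
    refine (ae_map_iff measurable_clearRoot.aemeasurable hq).2 ?_
    filter_upwards [hae] with τ hτ
    exact (hfree.clearRoot τ).mpr hτ
  rw [← h.map_clearRoot_tree] at h1
  filter_upwards [ae_of_ae_map h.aemeasurable_clearRoot_tree h1] with ω hω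
  exact (hfree.clearRoot _).mp hω

theorem lintegral_tree [IsProbabilityMeasure P] (h : IsBranchingNetwork P p ξ₀ N ξ) {f : MarkedTree → ℝ≥0∞}
    (hf : Measurable f) (hfree : RootFree f) :
    ∫⁻ ω, f (tree N ξ ω) ∂P = ∫⁻ τ, f τ ∂law p.toMeasure (P.map ξ₀) := by
  calc ∫⁻ ω, f (tree N ξ ω) ∂P = ∫⁻ ω, f (tree N ξ ω).clearRoot ∂P :=
        lintegral_congr fun ω => (hfree.clearRoot _).symm
    _ = ∫⁻ τ, f τ ∂(law p.toMeasure (P.map ξ₀)).map clearRoot := by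
        rw [← h.map_clearRoot_tree, lintegral_map' hf.aemeasurable h.aemeasurable_clearRoot_tree]
    _ = _ := by
        rw [lintegral_map hf measurable_clearRoot]
        exact lintegral_congr hfree.clearRoot

theorem aemeasurable_comp_tree (h : IsBranchingNetwork P p ξ₀ N ξ) {f : MarkedTree → ℝ≥0∞}
    (hf : Measurable f) (hfree : RootFree f) : AEMeasurable (fun ω => f (tree N ξ ω)) P :=
  (hf.comp_aemeasurable h.aemeasurable_clearRoot_tree).congr
    (ae_of_all _ fun _ => hfree.clearRoot _)

theorem ae_good (h : IsBranchingNetwork P p ξ₀ N ξ) (hp0 : p 0 = 0)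
    (hξ : ∀ᵐ ω ∂P, ξ₀ ω ≠ 0) : ∀ᵐ ω ∂P, (tree N ξ ω).Good := by
  have h1 : ∀ᵐ ω ∂P, ∀ u, 0 < N u ω := by
    rw [ae_all_iff]
    intro u
    have : ∀ᵐ n ∂P.map (N u), n ≠ 0 := by
      rw [(h.offspring_law u).map_eq, ae_iff]
      have : {n : ℕ | ¬n ≠ 0} = {0} := by ext; simp
      rw [this, PMF.toMeasure_apply_singleton _ _ (measurableSet_singleton _), hp0]
    filter_upwards [ae_of_ae_map (h.offspring_law u).aemeasurable this] with ω hω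
    exact Nat.pos_of_ne_zero hω
  have h2 : ∀ᵐ ω ∂P, ∀ x : {x : List ℕ // x ≠ []}, ξ x ω ≠ 0 := by
    rw [ae_all_iff]
    intro x
    have : ∀ᵐ y ∂P.map ξ₀, y ≠ 0 :=
      (ae_map_iff h.aemeasurable_mark (measurableSet_singleton (0 : ℝ≥0)).compl).2 hξ
    rw [← (h.hasLaw_mark x).map_eq] at this
    exact ae_of_ae_map (h.hasLaw_mark x).aemeasurable this
  filter_upwards [h1, h2] with ω h1 h2
  exact ⟨h1, fun u hu => pos_iff_ne_zero.2 (h2 ⟨u, hu⟩)⟩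

end IsBranchingNetwork

/-- An infinite mean would receive the default value `0`; a value above `1` therefore certifies
finiteness. -/
theorem lintegral_toMeasure_of_one_lt_offspringMean {p : PMF ℕ} (hm : 1 < offspringMean p) :
    ∫⁻ n : ℕ, (n : ℝ≥0∞) ∂p.toMeasure = offspringMean p := by
  have h : ∑' k : ℕ, (k : ℝ≥0∞) * p k ≠ ⊤ := by
    intro h
    rw [offspringMean, h] at hm
    simp at hm
  rw [offspringMean, ENNReal.coe_toNNReal h, lintegral_countable']
  exact tsum_congr fun k => by
    rw [PMF.toMeasure_apply_singleton _ _ (measurableSet_singleton _)]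

/-! ### Measurability of the convergence event. -/

namespace MarkedTree

/-- The normalized level sizes of `τ` and the conductances divided by `c` have the same limit. -/
def HaveCommonLimit (m : ℝ≥0) (c : ℕ → ℝ≥0∞) (τ : MarkedTree) : Prop :=
  ∃ w : ℝ≥0, Tendsto (fun k => (childMean m)^[k] 1 τ) atTop (𝓝 (w : ℝ≥0∞)) ∧
    Tendsto (fun n => cond m n τ / c n) atTop (𝓝 (w : ℝ≥0∞))

theorem rootFree_haveCommonLimit (m : ℝ≥0) (c : ℕ → ℝ≥0∞) :
    RootFree (HaveCommonLimit m c) := by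
  intro N ξ ξ' h
  have h1 : ∀ k, (childMean m)^[k] 1 (N, ξ) = (childMean m)^[k] 1 (N, ξ') := fun k =>
    rootFree_iterate_childMean_one m k N ξ ξ' h
  have h2 : ∀ n, cond m n (N, ξ) = cond m n (N, ξ') := fun n => rootFree_cond m n N ξ ξ' h
  unfold HaveCommonLimit
  simp_rw [h1, h2]

/-- Transferring the event to another probability space requires measurability. The quantifier over
uncountably many `w` is removed by naming the only candidate, the measurable limsup of the level
sizes. -/
theorem measurableSet_haveCommonLimit (m : ℝ≥0) (c : ℕ → ℝ≥0∞) :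
    MeasurableSet {τ | HaveCommonLimit m c τ} := by
  set L : MarkedTree → ℝ≥0∞ := fun τ => limsup (fun k => (childMean m)^[k] 1 τ) atTop
  have hu : ∀ k, Measurable ((childMean m)^[k] 1) := fun k =>
    measurable_iterate_childMean m k measurable_one
  have hL : Measurable L := Measurable.limsup hu
  have : {τ | HaveCommonLimit m c τ} =
      {τ | Tendsto (fun k => (childMean m)^[k] 1 τ) atTop (𝓝 (L τ))} ∩
        ({τ | Tendsto (fun n => cond m n τ / c n) atTop (𝓝 (L τ))} ∩ {τ | L τ ≠ ⊤}) := by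
    ext τ
    simp only [Set.mem_inter_iff, Set.mem_ofPred_eq]
    constructor
    · rintro ⟨w, h1, h2⟩
      have hLw : L τ = w := h1.limsup_eq
      rw [hLw]
      exact ⟨h1, h2, ENNReal.coe_ne_top⟩
    · rintro ⟨h1, h2, h3⟩
      refine ⟨(L τ).toNNReal, ?_⟩
      rw [ENNReal.coe_toNNReal h3]
      exact ⟨h1, h2⟩
  rw [this]
  refine (measurableSet_tendsto_fun hu hL).inter
    ((measurableSet_tendsto_fun (fun n => ?_) hL).inter ?_)
  · fun_prop
  · exact (hL (measurableSet_singleton ⊤)).compl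

end MarkedTree

/-! ### The main theorem. -/

theorem theorem1 {Ω : Type*} [MeasurableSpace Ω] (P : Measure Ω) [IsProbabilityMeasure P]
    (p : PMF ℕ) (ξ₀ : Ω → ℝ≥0) (N : List ℕ → Ω → ℕ) (ξ : List ℕ → Ω → ℝ≥0)
    (hnet : IsBranchingNetwork P p ξ₀ N ξ)
    (hp0 : p 0 = 0) (hm : 1 < offspringMean p)
    (hmoment : ∫⁻ ω, ((ξ₀ ω : ℝ≥0∞) + (ξ₀ ω : ℝ≥0∞)⁻¹ + (N [] ω : ℝ≥0∞) ^ 2) ∂P < ∞) :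
    let m : ℝ≥0 := offspringMean p
    let C : ℕ → Ω → ℝ≥0∞ := fun n ω => plantedTree.conductance m (N · ω) (ξ · ω) n
    let W : Ω → ℝ≥0 := fun ω => plantedTree.sizeLimit m (N · ω)
    (∀ n, 1 ≤ n → AEMeasurable (C n) P ∧ 0 < ∫⁻ ω, C n ω ∂P ∧ ∫⁻ ω, C n ω ∂P < ∞) ∧
    ∀ᵐ ω ∂P,
      Tendsto (fun n => plantedTree.normalizedSize m (N · ω) n) atTop (𝓝 (W ω)) ∧
      Tendsto (fun n => C n ω / ∫⁻ ω', C n ω' ∂P) atTop (𝓝 (W ω : ℝ≥0∞)) := by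
  intro m C W
  have hmpos : 0 < m := zero_lt_one.trans hm
  have hm0 : m ≠ 0 := hmpos.ne'
  have hmean : ∫⁻ n : ℕ, (n : ℝ≥0∞) ∂p.toMeasure = m :=
    lintegral_toMeasure_of_one_lt_offspringMean hm
  have hξ := hnet.aemeasurable_mark
  have hprob : IsProbabilityMeasure (P.map ξ₀) := Measure.isProbabilityMeasure_map hξ
  have hN2 : ∫⁻ n : ℕ, (n : ℝ≥0∞) ^ 2 ∂p.toMeasure < ⊤ := by
    rw [← (hnet.offspring_law []).map_eq, lintegral_map' (measurable_of_countable _).aemeasurable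
      (hnet.offspring_law []).aemeasurable]
    exact (lintegral_mono fun ω => le_add_self).trans_lt hmoment
  have hξinvP : ∫⁻ ω, (ξ₀ ω : ℝ≥0∞)⁻¹ ∂P < ⊤ :=
    (lintegral_mono fun ω => le_add_self.trans le_self_add).trans_lt hmoment
  have hξmean : ∫⁻ x : ℝ≥0, (x : ℝ≥0∞) ∂P.map ξ₀ < ⊤ := by
    rw [lintegral_map' (by fun_prop) hξ]
    exact (lintegral_mono fun ω => le_self_add.trans le_self_add).trans_lt hmoment
  have hξinv : ∫⁻ x : ℝ≥0, (x : ℝ≥0∞)⁻¹ ∂P.map ξ₀ < ⊤ := by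
    rwa [lintegral_map' (by fun_prop) hξ]
  -- As `0⁻¹ = ⊤`, integrability of `ξ₀⁻¹` rules out zero marks almost surely; with `p 0 = 0` this
  -- makes almost every tree good.
  have hξpos : ∀ᵐ ω ∂P, ξ₀ ω ≠ 0 := by
    filter_upwards [ae_lt_top' (by fun_prop) hξinvP.ne] with ω hω h0
    simp [h0] at hω
  have hξmean0 : ∫⁻ x : ℝ≥0, (x : ℝ≥0∞) ∂P.map ξ₀ ≠ 0 := by
    rw [lintegral_map' (by fun_prop) hξ]
    intro h0
    rw [lintegral_eq_zero_iff' (by fun_prop)] at h0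
    obtain ⟨ω, h1, h2⟩ := (hξpos.and h0).exists
    exact h1 (by simpa using h2)
  have hgood := hnet.ae_good hp0 hξpos
  have hC : ∀ n, 1 ≤ n → C n =ᵐ[P] fun ω => MarkedTree.cond m n (IsBranchingNetwork.tree N ξ ω) := by
    intro n hn
    filter_upwards [hgood] with ω hω
    exact plantedTree.conductance_eq_cond (τ := IsBranchingNetwork.tree N ξ ω) hmpos (Nat.one_le_iff_ne_zero.1 hn) hω
  have hEC : ∀ n, 1 ≤ n →
      ∫⁻ ω, C n ω ∂P = ∫⁻ τ, MarkedTree.cond m n τ ∂MarkedTree.law p.toMeasure (P.map ξ₀) := fun n hn => by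
    rw [lintegral_congr_ae (hC n hn), hnet.lintegral_tree (MarkedTree.measurable_cond m n) (MarkedTree.rootFree_cond m n)]
  refine ⟨fun n hn => ⟨?_, ?_, ?_⟩, ?_⟩
  · exact (hnet.aemeasurable_comp_tree (MarkedTree.measurable_cond m n) (MarkedTree.rootFree_cond m n)).congr
      (hC n hn).symm
  · rw [hEC n hn]
    exact pos_iff_ne_zero.2 (MarkedTree.lintegral_cond_ne_zero hm0 hmean n)
  · rw [hEC n hn]
    obtain ⟨k, rfl⟩ := Nat.exists_eq_add_of_le' hn
    exact (MarkedTree.lintegral_cond_succ_le hm0 hmean k).trans_lt hξinv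
  · have hae := hnet.ae_tree_of_ae_law
      (MarkedTree.measurableSet_haveCommonLimit m fun n => ∫⁻ τ, MarkedTree.cond m n τ ∂MarkedTree.law p.toMeasure (P.map ξ₀))
      (MarkedTree.rootFree_haveCommonLimit m _)
      (MarkedTree.ae_tendsto_cond_div hm hmean hN2 hξmean hξmean0 hξinv)
    filter_upwards [hae, hgood] with ω ⟨w, hw1, hw2⟩ hω
    have hsize : Tendsto (fun n => plantedTree.normalizedSize m (N · ω) n) atTop (𝓝 w) := by
      rw [← ENNReal.tendsto_coe]
      exact hw1.congr fun k =>
        (plantedTree.normalizedSize_eq hmpos k (IsBranchingNetwork.tree N ξ ω)).symm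
    have hW : W ω = w := hsize.limUnder_eq
    rw [hW]
    refine ⟨hsize, hw2.congr' ?_⟩
    filter_upwards [eventually_ge_atTop 1] with n hn
    rw [hEC n hn]
    congr 1
    exact (plantedTree.conductance_eq_cond (τ := IsBranchingNetwork.tree N ξ ω) hmpos
      (Nat.one_le_iff_ne_zero.1 hn) hω).symm
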